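/- Let $\mathbb{K}$ be a field of characteristic zero. For a finite simplicial complex $\mathcal{F}$ of dimension $m$, let $f_k^{\mathcal{F}}$ be the number of its $k$-dimensional faces (the empty face is not counted) and let $|\mathcal{F}|$ be its polyhedron (geometric realization). For a formal power series $\gamma(x)=\sum_{n\ge 0}\gamma_n x^n\in\mathbb{K}[[x]]$ put $$\chi(\gamma,\mathcal{F})=\sum_{k=0}^{m}\gamma_k f_k^{\mathcal{F}}\in\mathbb{K}.$$ Call $\gamma$ a homotopy invariant for a class $\mathcal{C}$ of finite simplicial complexes if $\chi(\gamma,\mathcal{F}_1)=\chi(\gamma,\mathcal{F}_2)$ for all $\mathcal{F}_1,\mathcal{F}_2\in\mathcal{C}$ such that $|\mathcal{F}_1|$ and $|\mathcal{F}_2|$ have the same homotopy type. Theorem. Let $\gamma\in\mathbb{K}[[x]]$, and let $\mathcal{C}$ be any one of the following three classes: (i) the simplices $\Delta_n$, $n\ge 0$, where $\Delta_n$ consists of all non-empty subsets of a set of $n+1$ affinely independent vertices; (ii) the triangulations of closed Euclidean balls, that is, the finite simplicial complexes $\mathcal{F}$ such that $|\mathcal{F}|$ is homeomorphic to the closed unit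 ball of $\mathbb{R}^n$ for some $n\ge 0$; (iii) all finite simplicial complexes. Then $\gamma$ is a homotopy invariant for $\mathcal{C}$ if and only if $\gamma(x)=\dfrac{k}{1+x}$ for some $k\in\mathbb{K}$. -/

import Mathlib

open scoped PowerSeries

noncomputable section

/-- A finite (geometric) simplicial complex, lying in some Euclidean space `ℝ^N`, where `N` is
arbitrary. As in Mathlib, faces are non-empty; they are given by their vertex sets. -/
structure FiniteComplex where
  ambientDim : ℕ
  complex : Geometry.SimplicialComplex ℝ (EuclideanSpace ℝ (Fin ambientDim))
  finite_faces : complex.faces.Finite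

namespace FiniteComplex

/-- The polyhedron `|F|`: the union of the simplices of `F`, with the subspace topology. -/
def polyhedron (F : FiniteComplex) : Set (EuclideanSpace ℝ (Fin F.ambientDim)) :=
  F.complex.space

/-- `f_k`: the number of `k`-dimensional faces, i.e. of faces with `k + 1` vertices. -/
def fVector (F : FiniteComplex) (k : ℕ) : ℕ :=
  {s ∈ F.complex.faces | s.card = k + 1}.ncard

/-- The dimension of `F`: the largest dimension of a face (`0` for the empty complex). -/
def dim (F : FiniteComplex) : ℕ :=
  sSup ((fun s => s.card - 1) '' F.complex.faces)

/-- `F` is an `n`-simplex for some `n`: it consists of all non-empty subsets of a set of `n + 1`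
(affinely independent) vertices. -/
def IsSimplex (F : FiniteComplex) : Prop :=
  ∃ n : ℕ, ∃ V : Finset (EuclideanSpace ℝ (Fin F.ambientDim)),
    V.card = n + 1 ∧ F.complex.faces = {s | s.Nonempty ∧ s ⊆ V}

/-- `F` triangulates a closed Euclidean ball of some dimension `n ≥ 0`. -/
def IsBall (F : FiniteComplex) : Prop :=
  ∃ n : ℕ, Nonempty (F.polyhedron ≃ₜ Metric.closedBall (0 : EuclideanSpace ℝ (Fin n)) 1)

end FiniteComplex

/-- `χ(γ, F) = ∑_{k=0}^m γ_k f_k`, where `m` is the dimension of `F`. -/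
def seriesChar {K : Type*} [Field K] (γ : K⟦X⟧) (F : FiniteComplex) : K :=
  ∑ k ∈ Finset.range (F.dim + 1), PowerSeries.coeff k γ * (F.fVector k : K)

/-- `γ` is a homotopy invariant for the class `C` of finite simplicial complexes. -/
def IsHomotopyInvariantOn {K : Type*} [Field K] (γ : K⟦X⟧) (C : Set FiniteComplex) : Prop :=
  ∀ F ∈ C, ∀ G ∈ C, Nonempty (ContinuousMap.HomotopyEquiv F.polyhedron G.polyhedron) →
    seriesChar γ F = seriesChar γ G

end

/-! Necessity is linear algebra. Simplices are contractible, so invariance forces χ(γ, Δ_n) = χ(γ,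
Δ_0) = γ_0 for all n. Since f_k(Δ_n) = C(n+1, k+1), this system is triangular with unit diagonal:
γ_0 determines γ, and γ_n = (-1)^n γ_0 is a solution (`IsHomotopyInvariantOn.exists_eq`). The
simplices used are full-dimensional in ℝ^n, hence also balls, so one argument serves all three
classes.

Sufficiency is the homotopy invariance of the Euler characteristic. It comes from a cohomology
defined directly for subsets A of a metric space: cochains are arbitrary rational functions on lists
of ambient points, modulo those vanishing on all ε-small lists in A for some ε. Restriction is then
the identity on representatives and cochains extend by zero, which makes Mayer–Vietoris explicit.
The empty list supplies the augmentation, so the theory is reduced. Only the parity of the length is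
kept, so the long exact sequence becomes a hexagon. On compact sets, uniform continuity and the
prism operator give homotopy invariance (`IsHomotopicOn.sub_mem_coboundaries`).

The Euler characteristic is computed by removing a simplex σ of maximal dimension. The polyhedron is
covered by σ and the complement of a neighbourhood of its barycentre; the latter retracts onto the
remaining complex, the overlap onto ∂σ (`IsSimplicialComplex.hasEulerChar_of_erase`). Induction
yields 1 + ∑ (-1)^|s|, a quantity depending only on the homotopy type. -/

/-! ### Augmented cochains on lists of points -/

section Cochains

variable {E E' : Type*}

/-- The alternating coboundary of a cochain, i.e. of a function on lists of points, written
recursively in the first point. -/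
def listCoboundary : (List E → ℚ) → List E → ℚ
  | _, [] => 0
  | φ, a :: l => φ l - listCoboundary (fun m => φ (a :: m)) l

@[simp] theorem listCoboundary_nil (φ : List E → ℚ) : listCoboundary φ [] = 0 := rfl

theorem listCoboundary_cons (φ : List E → ℚ) (a : E) (l : List E) :
    listCoboundary φ (a :: l) = φ l - listCoboundary (fun m => φ (a :: m)) l := rfl

theorem listCoboundary_add (φ ψ : List E → ℚ) (l : List E) :
    listCoboundary (φ + ψ) l = listCoboundary φ l + listCoboundary ψ l := by
  induction l generalizing φ ψ with
  | nil => simp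
  | cons a l ih =>
    have := ih (fun m => φ (a :: m)) (fun m => ψ (a :: m))
    simp only [listCoboundary_cons, Pi.add_apply]
    rw [show (fun m => φ (a :: m) + ψ (a :: m)) =
      (fun m => φ (a :: m)) + (fun m => ψ (a :: m)) from rfl, this]
    ring

theorem listCoboundary_smul (c : ℚ) (φ : List E → ℚ) (l : List E) :
    listCoboundary (c • φ) l = c * listCoboundary φ l := by
  induction l generalizing φ with
  | nil => simp
  | cons a l ih =>
    have := ih (fun m => φ (a :: m))
    simp only [listCoboundary_cons, Pi.smul_apply, smul_eq_mul]
    rw [show (fun m => c * φ (a :: m)) = c • (fun m => φ (a :: m)) from rfl, this]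
    ring

/-- The coboundary as a linear map. -/
def coboundary (E : Type*) : (List E → ℚ) →ₗ[ℚ] (List E → ℚ) where
  toFun := listCoboundary
  map_add' φ ψ := funext (listCoboundary_add φ ψ)
  map_smul' c φ := funext (listCoboundary_smul c φ)

@[simp] theorem coboundary_nil (φ : List E → ℚ) : coboundary E φ [] = 0 := rfl

theorem coboundary_cons (φ : List E → ℚ) (a : E) (l : List E) :
    coboundary E φ (a :: l) = φ l - coboundary E (fun m => φ (a :: m)) l := rfl

theorem coboundary_cons_fun (φ : List E → ℚ) (a : E) :
    (fun l => coboundary E φ (a :: l)) = φ - coboundary E (fun m => φ (a :: m)) := rfl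

@[simp] theorem coboundary_coboundary (φ : List E → ℚ) :
    coboundary E (coboundary E φ) = 0 := by
  funext l
  induction l generalizing φ with
  | nil => rfl
  | cons a l ih =>
    rw [coboundary_cons, coboundary_cons_fun, map_sub, Pi.sub_apply, ih]
    simp

/-- The coboundary at `l` is a signed sum over `l` with one entry deleted; these lists are as small
as `l`. -/
theorem coboundary_eq_zero {φ : List E → ℚ} {l : List E}
    (h : ∀ m, m ⊆ l → m.length + 1 = l.length → φ m = 0) : coboundary E φ l = 0 := by
  induction l generalizing φ with
  | nil => rfl
  | cons a l ih =>
    rw [coboundary_cons, h l (by simp) (by simp), ih, sub_zero]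
    intro m hm hlen
    exact h _ (List.cons_subset_cons a hm) (by simpa using hlen)

/-- Pullback of cochains along a map. -/
def cochainPullback (f : E → E') : (List E' → ℚ) →ₗ[ℚ] (List E → ℚ) :=
  LinearMap.funLeft ℚ ℚ (List.map f)

@[simp] theorem cochainPullback_apply (f : E → E') (φ : List E' → ℚ) (l : List E) :
    cochainPullback f φ l = φ (l.map f) := rfl

theorem coboundary_cochainPullback (f : E → E') (φ : List E' → ℚ) :
    coboundary E (cochainPullback f φ) = cochainPullback f (coboundary E' φ) := by
  funext l
  induction l generalizing φ with
  | nil => rfl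
  | cons a l ih =>
    have := ih (fun m => φ (f a :: m))
    rw [coboundary_cons]
    simp only [cochainPullback_apply, List.map_cons, coboundary_cons] at this ⊢
    rw [← this]
    rfl

/-- The prism operator between the pullbacks along two maps. -/
def prism (f g : E → E') : (List E' → ℚ) → List E → ℚ
  | _, [] => 0
  | φ, x :: l => φ (f x :: g x :: l.map g) - prism f g (fun m => φ (f x :: m)) l

theorem prism_cons (f g : E → E') (φ : List E' → ℚ) (x : E) (l : List E) :
    prism f g φ (x :: l) =
      φ (f x :: g x :: l.map g) - prism f g (fun m => φ (f x :: m)) l := rfl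

theorem prism_sub (f g : E → E') (φ ψ : List E' → ℚ) (l : List E) :
    prism f g (φ - ψ) l = prism f g φ l - prism f g ψ l := by
  induction l generalizing φ ψ with
  | nil => simp [prism]
  | cons a l ih =>
    have := ih (fun m => φ (f a :: m)) (fun m => ψ (f a :: m))
    simp only [prism_cons, Pi.sub_apply]
    rw [show (fun m => φ (f a :: m) - ψ (f a :: m)) =
      (fun m => φ (f a :: m)) - (fun m => ψ (f a :: m)) from rfl, this]
    ring

theorem prism_eq_zero {f g : E → E'} {φ : List E' → ℚ} {l : List E}
    (h : ∀ m : List E', (∀ y ∈ m, ∃ x ∈ l, y = f x ∨ y = g x) → m.length = l.length + 1 → φ m = 0) :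
    prism f g φ l = 0 := by
  induction l generalizing φ with
  | nil => rfl
  | cons a l ih =>
    rw [prism_cons, h, ih, sub_zero]
    · intro m hm hlen
      refine h _ (fun y hy => ?_) (by simpa using hlen)
      rcases List.mem_cons.1 hy with rfl | hy
      · exact ⟨a, by simp, Or.inl rfl⟩
      · obtain ⟨x, hx, h'⟩ := hm y hy
        exact ⟨x, List.mem_cons_of_mem _ hx, h'⟩
    · intro y hy
      simp only [List.mem_cons, List.mem_map] at hy
      rcases hy with rfl | rfl | ⟨x, hx, rfl⟩
      · exact ⟨a, by simp, Or.inl rfl⟩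
      · exact ⟨a, by simp, Or.inr rfl⟩
      · exact ⟨x, List.mem_cons_of_mem _ hx, Or.inr rfl⟩
    · simp

/-- The chain homotopy formula. Unrolled, `prism f g φ` is the alternating sum of φ(f x₀, …, f xᵢ, g
xᵢ, …, g xₙ). The recursion on the first point reduces the usual cancellation to naturality of the
coboundary under `g`. -/
theorem coboundary_prism_add (f g : E → E') (φ : List E' → ℚ) (l : List E) :
    coboundary E (prism f g φ) l + prism f g (coboundary E' φ) l =
      φ (l.map g) - φ (l.map f) := by
  induction l generalizing φ with
  | nil => simp [prism]
  | cons x l ih =>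
    have h1 : (fun m => prism f g φ (x :: m)) =
        cochainPullback g (fun m => φ (f x :: g x :: m)) - prism f g (fun m => φ (f x :: m)) := rfl
    have ih' := ih (fun m => φ (f x :: m))
    rw [coboundary_cons, prism_cons, coboundary_cons_fun, prism_sub, h1, map_sub, Pi.sub_apply,
      coboundary_cochainPullback, coboundary_cons, coboundary_cons]
    simp only [cochainPullback_apply, List.map_cons]
    linarith

open Classical in
/-- Extension by zero of a cochain on `U`. -/
noncomputable def cochainIndicator (U : Set E) : (List E → ℚ) →ₗ[ℚ] (List E → ℚ) where
  toFun φ l := if ∀ x ∈ l, x ∈ U then φ l else 0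
  map_add' φ ψ := by funext l; dsimp; split_ifs <;> simp
  map_smul' c φ := by funext l; dsimp; split_ifs <;> simp

theorem cochainIndicator_of_forall {U : Set E} {l : List E} (h : ∀ x ∈ l, x ∈ U)
    (φ : List E → ℚ) : cochainIndicator U φ l = φ l := if_pos h

theorem cochainIndicator_of_not_forall {U : Set E} {l : List E} (h : ¬ ∀ x ∈ l, x ∈ U)
    (φ : List E → ℚ) : cochainIndicator U φ l = 0 := if_neg h

end Cochains

/-! ### Subquotients -/

section SubQuotient

variable {M M' : Type*} [AddCommGroup M] [Module ℚ M] [AddCommGroup M'] [Module ℚ M']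

/-- The quotient of a submodule by (its intersection with) another submodule. -/
abbrev SubQuotient (Z B : Submodule ℚ M) : Type _ := Z ⧸ B.submoduleOf Z

namespace SubQuotient

variable {Z B : Submodule ℚ M} {Z' B' : Submodule ℚ M'}

/-- The class of an element. -/
def mk (z : M) (hz : z ∈ Z) : SubQuotient Z B := (B.submoduleOf Z).mkQ ⟨z, hz⟩

theorem exists_mk (x : SubQuotient Z B) : ∃ z, ∃ hz : z ∈ Z, x = mk z hz := by
  obtain ⟨⟨z, hz⟩, rfl⟩ := Submodule.mkQ_surjective _ x
  exact ⟨z, hz, rfl⟩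

theorem mk_eq_mk {z w : M} {hz : z ∈ Z} {hw : w ∈ Z} :
    (mk z hz : SubQuotient Z B) = mk w hw ↔ z - w ∈ B := by
  simp only [mk, Submodule.mkQ_apply]
  rw [Submodule.Quotient.eq]
  rfl

theorem mk_eq_zero {z : M} {hz : z ∈ Z} : (mk z hz : SubQuotient Z B) = 0 ↔ z ∈ B := by
  simp only [mk, Submodule.mkQ_apply]
  rw [Submodule.Quotient.mk_eq_zero]
  rfl

/-- The map of subquotients induced by a linear map. -/
def map (T : M →ₗ[ℚ] M') (hZ : ∀ z ∈ Z, T z ∈ Z') (hB : ∀ z ∈ B, T z ∈ B') :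
    SubQuotient Z B →ₗ[ℚ] SubQuotient Z' B' :=
  Submodule.mapQ _ _ (T.restrict hZ) fun z hz => hB z hz

theorem map_mk (T : M →ₗ[ℚ] M') (hZ : ∀ z ∈ Z, T z ∈ Z') (hB : ∀ z ∈ B, T z ∈ B') (z : M)
    (hz : z ∈ Z) : map T hZ hB (mk z hz) = mk (T z) (hZ z hz) := rfl

end SubQuotient

end SubQuotient

/-! ### Exact hexagons -/

theorem finite_of_exact {A B C : Type*} [AddCommGroup A] [Module ℚ A] [AddCommGroup B]
    [Module ℚ B] [AddCommGroup C] [Module ℚ C] [Module.Finite ℚ A] [Module.Finite ℚ C]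
    {f : A →ₗ[ℚ] B} {g : B →ₗ[ℚ] C} (h : Function.Exact f g) :
    Module.Finite ℚ B ∧
      Module.finrank ℚ B = Module.finrank ℚ f.range + Module.finrank ℚ g.range := by
  have hk : g.ker = f.range := LinearMap.exact_iff.1 h
  have h1 : Module.Finite ℚ g.ker := by rw [hk]; infer_instance
  have h2 : Module.Finite ℚ (B ⧸ g.ker) := Module.Finite.equiv g.quotKerEquivRange.symm
  have h3 : Module.Finite ℚ B := Module.Finite.of_submodule_quotient g.ker
  refine ⟨h3, ?_⟩
  rw [← g.finrank_range_add_finrank_ker, hk, add_comm]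

/-- Each of the six dimensions is the sum of the ranks of the incoming and outgoing maps, so all
ranks cancel in the alternating sum. -/
theorem euler_char_of_exact_hexagon {A B C : ZMod 2 → Type*}
    [∀ i, AddCommGroup (A i)] [∀ i, Module ℚ (A i)] [∀ i, AddCommGroup (B i)]
    [∀ i, Module ℚ (B i)] [∀ i, AddCommGroup (C i)] [∀ i, Module ℚ (C i)]
    [∀ i, Module.Finite ℚ (B i)] [∀ i, Module.Finite ℚ (C i)]
    (α : ∀ i, A i →ₗ[ℚ] B i) (β : ∀ i, B i →ₗ[ℚ] C i) (γ : ∀ i, C i →ₗ[ℚ] A (i + 1))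
    (h₁ : ∀ i, Function.Exact (α i) (β i)) (h₂ : ∀ i, Function.Exact (β i) (γ i))
    (h₃ : ∀ i, Function.Exact (γ i) (α (i + 1))) :
    (∀ i, Module.Finite ℚ (A i)) ∧
      (Module.finrank ℚ (A 0) : ℤ) - Module.finrank ℚ (A 1) =
        (Module.finrank ℚ (B 0) - Module.finrank ℚ (B 1)) -
          (Module.finrank ℚ (C 0) - Module.finrank ℚ (C 1)) := by
  have hA1 : Module.Finite ℚ (A 1) ∧ Module.finrank ℚ (A 1) =
      Module.finrank ℚ (γ 0).range + Module.finrank ℚ (α 1).range := finite_of_exact (h₃ 0)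
  -- In `ZMod 2` the index `1 + 1` computes to `0`, which closes the hexagon.
  have hA0 : Module.Finite ℚ (A 0) ∧ Module.finrank ℚ (A 0) =
      Module.finrank ℚ (γ 1).range + Module.finrank ℚ (α 0).range := finite_of_exact (h₃ 1)
  have hfin : ∀ i, Module.Finite ℚ (A i) := by
    intro i
    fin_cases i
    · exact hA0.1
    · exact hA1.1
  refine ⟨hfin, ?_⟩
  have hB0 := (finite_of_exact (h₁ 0)).2
  have hB1 := (finite_of_exact (h₁ 1)).2
  have hC0 := (finite_of_exact (h₂ 0)).2
  have hC1 := (finite_of_exact (h₂ 1)).2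
  rw [hA0.2, hA1.2, hB0, hB1, hC0, hC1]
  push_cast
  ring

/-! ### Uniform Alexander–Spanier cohomology -/

section Cohomology

open Topology

variable {E E' : Type*} [PseudoMetricSpace E] [PseudoMetricSpace E']

/-- A list of points of `A` with pairwise distances less than `ε`. -/
def IsSmallList (A : Set E) (ε : ℝ) (l : List E) : Prop :=
  (∀ x ∈ l, x ∈ A) ∧ ∀ x ∈ l, ∀ y ∈ l, dist x y < ε

theorem IsSmallList.mono {A B : Set E} {ε δ : ℝ} {l m : List E} (h : IsSmallList A ε l)
    (hm : m ⊆ l) (hAB : A ⊆ B) (hε : ε ≤ δ) : IsSmallList B δ m :=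
  ⟨fun x hx => hAB (h.1 x (hm hx)), fun x hx y hy => (h.2 x (hm hx) y (hm hy)).trans_le hε⟩

/-- The cochains vanishing on all sufficiently small lists in `A` whose length has parity `i`. -/
def nullCochains (A : Set E) (i : ZMod 2) : Submodule ℚ (List E → ℚ) where
  carrier := {φ | ∃ ε > 0, ∀ l, IsSmallList A ε l → (l.length : ZMod 2) = i → φ l = 0}
  zero_mem' := ⟨1, one_pos, fun _ _ _ => rfl⟩
  add_mem' := by
    rintro φ ψ ⟨ε, hε, h⟩ ⟨δ, hδ, h'⟩
    refine ⟨min ε δ, lt_min hε hδ, fun l hl hi => ?_⟩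
    rw [Pi.add_apply, h l (hl.mono (List.Subset.refl _) le_rfl (min_le_left _ _)) hi,
      h' l (hl.mono (List.Subset.refl _) le_rfl (min_le_right _ _)) hi, add_zero]
  smul_mem' := by
    rintro c φ ⟨ε, hε, h⟩
    exact ⟨ε, hε, fun l hl hi => by rw [Pi.smul_apply, h l hl hi, smul_zero]⟩

theorem mem_nullCochains {A : Set E} {i : ZMod 2} {φ : List E → ℚ} :
    φ ∈ nullCochains A i ↔
      ∃ ε > 0, ∀ l, IsSmallList A ε l → (l.length : ZMod 2) = i → φ l = 0 := Iff.rfl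

theorem nullCochains_anti {A B : Set E} (h : A ⊆ B) (i : ZMod 2) :
    nullCochains B i ≤ nullCochains A i := by
  rintro φ ⟨ε, hε, h'⟩
  exact ⟨ε, hε, fun l hl hi => h' l (hl.mono (List.Subset.refl _) h le_rfl) hi⟩

theorem coboundary_mem_nullCochains {A : Set E} {i : ZMod 2} {φ : List E → ℚ}
    (h : φ ∈ nullCochains A i) : coboundary E φ ∈ nullCochains A (i + 1) := by
  obtain ⟨ε, hε, h⟩ := h
  refine ⟨ε, hε, fun l hl hi => coboundary_eq_zero fun m hm hlen => ?_⟩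
  refine h m (hl.mono hm le_rfl le_rfl) ?_
  rw [← hlen] at hi
  push_cast at hi
  exact add_right_cancel hi

/-- Cocycles modulo cochains vanishing on small lists. -/
def cocycles (A : Set E) (i : ZMod 2) : Submodule ℚ (List E → ℚ) :=
  (nullCochains A (i + 1)).comap (coboundary E)

theorem mem_cocycles {A : Set E} {i : ZMod 2} {φ : List E → ℚ} :
    φ ∈ cocycles A i ↔ coboundary E φ ∈ nullCochains A (i + 1) := Iff.rfl

/-- Coboundaries modulo cochains vanishing on small lists. -/
def coboundaries (A : Set E) (i : ZMod 2) : Submodule ℚ (List E → ℚ) :=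
  LinearMap.range (coboundary E) ⊔ nullCochains A i

theorem mem_coboundaries {A : Set E} {i : ZMod 2} {φ : List E → ℚ} :
    φ ∈ coboundaries A i ↔ ∃ ψ, φ - coboundary E ψ ∈ nullCochains A i := by
  simp only [coboundaries, Submodule.mem_sup, LinearMap.mem_range, exists_exists_eq_and]
  constructor
  · rintro ⟨ψ, ν, hν, rfl⟩
    exact ⟨ψ, by simpa using hν⟩
  · rintro ⟨ψ, h⟩
    exact ⟨ψ, _, h, by abel⟩

theorem nullCochains_le_coboundaries (A : Set E) (i : ZMod 2) :
    nullCochains A i ≤ coboundaries A i := le_sup_right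

theorem coboundary_mem_coboundaries (A : Set E) (i : ZMod 2) (φ : List E → ℚ) :
    coboundary E φ ∈ coboundaries A i :=
  Submodule.mem_sup_left ⟨φ, rfl⟩

theorem cocycles_anti {A B : Set E} (h : A ⊆ B) (i : ZMod 2) : cocycles B i ≤ cocycles A i :=
  Submodule.comap_mono (nullCochains_anti h _)

theorem coboundaries_anti {A B : Set E} (h : A ⊆ B) (i : ZMod 2) :
    coboundaries B i ≤ coboundaries A i :=
  sup_le_sup_left (nullCochains_anti h _) _

/-- The reduced uniform Alexander–Spanier cohomology of `A`, with degrees taken modulo two and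
shifted so that a cochain on lists of length `n` has degree `n`. -/
abbrev Cohomology (A : Set E) (i : ZMod 2) : Type _ := SubQuotient (cocycles A i) (coboundaries A i)

/-- The restriction map in cohomology. -/
def cohomologyRes {A B : Set E} (h : A ⊆ B) (i : ZMod 2) : Cohomology B i →ₗ[ℚ] Cohomology A i :=
  SubQuotient.map LinearMap.id (fun _ hz => cocycles_anti h i hz)
    fun _ hz => coboundaries_anti h i hz

theorem cohomologyRes_mk {A B : Set E} (h : A ⊆ B) {i : ZMod 2} {z : List E → ℚ}
    (hz : z ∈ cocycles B i) :
    cohomologyRes h i (SubQuotient.mk z hz) = SubQuotient.mk z (cocycles_anti h i hz) := rfl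

/-! #### Mayer–Vietoris -/

/-- The two sets `U`, `V` cover `X`, and every sufficiently small subset of `X` lies in one of
them. -/
structure IsUniformCover (X U V : Set E) : Prop where
  left_subset : U ⊆ X
  right_subset : V ⊆ X
  exists_small : ∃ δ > 0, ∀ l, IsSmallList X δ l → (∀ x ∈ l, x ∈ U) ∨ ∀ x ∈ l, x ∈ V

/-- Nullity on `X` can be tested on `U` and `V` separately. This is the only use of the smallness
condition on the cover. -/
theorem IsUniformCover.nullCochains_inf_le {X U V : Set E} (h : IsUniformCover X U V)
    {i : ZMod 2} {φ : List E → ℚ} (hU : φ ∈ nullCochains U i) (hV : φ ∈ nullCochains V i) :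
    φ ∈ nullCochains X i := by
  obtain ⟨δ, hδ, hs⟩ := h.exists_small
  obtain ⟨ε, hε, hU⟩ := hU
  obtain ⟨ε', hε', hV⟩ := hV
  refine ⟨min δ (min ε ε'), by positivity, fun l hl hi => ?_⟩
  rcases hs l (hl.mono (List.Subset.refl _) le_rfl (min_le_left _ _)) with h' | h'
  · exact hU l ⟨h', fun x hx y hy => (hl.2 x hx y hy).trans_le
      ((min_le_right _ _).trans (min_le_left _ _))⟩ hi
  · exact hV l ⟨h', fun x hx y hy => (hl.2 x hx y hy).trans_le
      ((min_le_right _ _).trans (min_le_right _ _))⟩ hi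

theorem sub_cochainIndicator_mem (U : Set E) (i : ZMod 2) (φ : List E → ℚ) :
    φ - cochainIndicator U φ ∈ nullCochains U i :=
  ⟨1, one_pos, fun l hl _ => by
    rw [Pi.sub_apply, cochainIndicator_of_forall hl.1, sub_self]⟩

/-- With `sub_cochainIndicator_mem`, this splits a cochain null on `U ∩ V` into a part null on `U`
and a part null on `V`. -/
theorem cochainIndicator_mem {U V : Set E} {i : ZMod 2} {φ : List E → ℚ}
    (h : φ ∈ nullCochains (U ∩ V) i) : cochainIndicator U φ ∈ nullCochains V i := by
  obtain ⟨ε, hε, h⟩ := h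
  refine ⟨ε, hε, fun l hl hi => ?_⟩
  by_cases hU : ∀ x ∈ l, x ∈ U
  · rw [cochainIndicator_of_forall hU]
    exact h l ⟨fun x hx => ⟨hU x hx, hl.1 x hx⟩, hl.2⟩ hi
  · exact cochainIndicator_of_not_forall hU φ

variable {X U V : Set E}

/-- The zigzag: lift φ to the pair (φ on `U`, 0 on `V`) and take coboundaries. They agree on `U ∩ V`
up to null cochains and glue to the indicator of `U` times dφ. -/
theorem IsUniformCover.connecting_mem_cocycles (h : IsUniformCover X U V) {i : ZMod 2}
    {φ : List E → ℚ} (hφ : φ ∈ cocycles (U ∩ V) i) :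
    cochainIndicator U (coboundary E φ) ∈ cocycles X (i + 1) := by
  refine h.nullCochains_inf_le ?_ (coboundary_mem_nullCochains (cochainIndicator_mem hφ))
  have := coboundary_mem_nullCochains (sub_cochainIndicator_mem U (i + 1) (coboundary E φ))
  rw [map_sub, coboundary_coboundary, zero_sub] at this
  exact neg_mem_iff.1 this

theorem IsUniformCover.connecting_mem_coboundaries (h : IsUniformCover X U V) {i : ZMod 2}
    {φ : List E → ℚ} (hφ : φ ∈ coboundaries (U ∩ V) i) :
    cochainIndicator U (coboundary E φ) ∈ coboundaries X (i + 1) := by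
  obtain ⟨ψ, hψ⟩ := mem_coboundaries.1 hφ
  -- Passing to ν keeps the coboundary and makes the cochain null on `U ∩ V`, so that its extension
  -- by zero is a primitive.
  set ν := φ - coboundary E ψ with hν
  have hd : coboundary E φ = coboundary E ν := by rw [hν, map_sub, coboundary_coboundary, sub_zero]
  rw [hd]
  have hV := cochainIndicator_mem hψ
  refine mem_coboundaries.2 ⟨cochainIndicator U ν, h.nullCochains_inf_le ?_ ?_⟩
  · have h1 := sub_cochainIndicator_mem U (i + 1) (coboundary E ν)
    have h2 := coboundary_mem_nullCochains (sub_cochainIndicator_mem U i ν)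
    have := sub_mem h2 h1
    rw [map_sub] at this
    convert this using 1
    abel
  · exact sub_mem (cochainIndicator_mem (coboundary_mem_nullCochains hψ))
      (coboundary_mem_nullCochains hV)

/-- The connecting map of the Mayer–Vietoris sequence. -/
noncomputable def IsUniformCover.connecting (h : IsUniformCover X U V) (i : ZMod 2) :
    Cohomology (U ∩ V) i →ₗ[ℚ] Cohomology X (i + 1) :=
  SubQuotient.map ((cochainIndicator U).comp (coboundary E))
    (fun _ hφ => h.connecting_mem_cocycles hφ) fun _ hφ => h.connecting_mem_coboundaries hφ

theorem IsUniformCover.connecting_mk (h : IsUniformCover X U V) {i : ZMod 2} {φ : List E → ℚ}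
    (hφ : φ ∈ cocycles (U ∩ V) i) :
    h.connecting i (SubQuotient.mk φ hφ) =
      SubQuotient.mk (cochainIndicator U (coboundary E φ)) (h.connecting_mem_cocycles hφ) := rfl

theorem IsUniformCover.exact_res_res (h : IsUniformCover X U V)
    (hV : ∀ i, cocycles V i ≤ coboundaries V i) (i : ZMod 2) :
    Function.Exact (cohomologyRes h.left_subset i)
      (cohomologyRes (Set.inter_subset_left : U ∩ V ⊆ U) i) := by
  intro y
  constructor
  · intro hy
    obtain ⟨φ, hφ, rfl⟩ := SubQuotient.exists_mk y
    rw [cohomologyRes_mk, SubQuotient.mk_eq_zero] at hy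
    obtain ⟨ψ, hψ⟩ := mem_coboundaries.1 hy
    set ν := φ - coboundary E ψ with hν
    have ha := sub_cochainIndicator_mem U i ν
    have hb := cochainIndicator_mem hψ
    -- The glued cochain: up to null cochains it is φ on `U` and dψ on `V`.
    have hmem : φ - (ν - cochainIndicator U ν) ∈ cocycles X i := by
      refine h.nullCochains_inf_le ?_ ?_
      · rw [map_sub]
        exact sub_mem (mem_cocycles.1 hφ) (coboundary_mem_nullCochains ha)
      · have : φ - (ν - cochainIndicator U ν) = coboundary E ψ + cochainIndicator U ν := by
          rw [hν]; abel
        rw [this, map_add, coboundary_coboundary, zero_add]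
        exact coboundary_mem_nullCochains hb
    refine ⟨SubQuotient.mk _ hmem, ?_⟩
    rw [cohomologyRes_mk, SubQuotient.mk_eq_mk]
    have := neg_mem (nullCochains_le_coboundaries U i ha)
    convert this using 1
    abel
  · rintro ⟨x, rfl⟩
    obtain ⟨ω, hω, rfl⟩ := SubQuotient.exists_mk x
    rw [cohomologyRes_mk, cohomologyRes_mk, SubQuotient.mk_eq_zero]
    exact coboundaries_anti Set.inter_subset_right i (hV i (cocycles_anti h.right_subset i hω))

theorem IsUniformCover.exact_res_connecting (h : IsUniformCover X U V)
    (hV : ∀ i, cocycles V i ≤ coboundaries V i) (i : ZMod 2) :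
    Function.Exact (cohomologyRes (Set.inter_subset_left : U ∩ V ⊆ U) i) (h.connecting i) := by
  intro y
  constructor
  · intro hy
    obtain ⟨φ, hφ, rfl⟩ := SubQuotient.exists_mk y
    rw [connecting_mk, SubQuotient.mk_eq_zero] at hy
    obtain ⟨ψ, hψ⟩ := mem_coboundaries.1 hy
    -- On `V` the connecting representative is null, so ψ is a cocycle there, hence a coboundary;
    -- subtracting it from φ does not change the class on `U ∩ V`.
    have hψV : ψ ∈ cocycles V i := by
      have h1 := nullCochains_anti h.right_subset _ hψ
      have := sub_mem (cochainIndicator_mem hφ) h1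
      rwa [sub_sub_cancel] at this
    refine ⟨SubQuotient.mk (φ - ψ) ?_, ?_⟩
    · have h1 := nullCochains_anti h.left_subset _ hψ
      have := add_mem (sub_cochainIndicator_mem U (i + 1) (coboundary E φ)) h1
      rw [mem_cocycles, map_sub]
      convert this using 1
      abel
    · rw [cohomologyRes_mk, SubQuotient.mk_eq_mk]
      have := neg_mem (coboundaries_anti Set.inter_subset_right i (hV i hψV) :
        ψ ∈ coboundaries (U ∩ V) i)
      convert this using 1
      abel
  · rintro ⟨x, rfl⟩
    obtain ⟨φ, hφ, rfl⟩ := SubQuotient.exists_mk x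
    rw [cohomologyRes_mk, connecting_mk, SubQuotient.mk_eq_zero]
    refine nullCochains_le_coboundaries X _ (h.nullCochains_inf_le ?_
      (cochainIndicator_mem (nullCochains_anti Set.inter_subset_left _ hφ)))
    have := sub_mem (mem_cocycles.1 hφ) (sub_cochainIndicator_mem U (i + 1) (coboundary E φ))
    rwa [sub_sub_cancel] at this

theorem IsUniformCover.exact_connecting_res (h : IsUniformCover X U V)
    (hV : ∀ i, cocycles V i ≤ coboundaries V i) (i : ZMod 2) :
    Function.Exact (h.connecting i) (cohomologyRes h.left_subset (i + 1)) := by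
  intro y
  constructor
  · intro hy
    obtain ⟨ω, hω, rfl⟩ := SubQuotient.exists_mk y
    rw [cohomologyRes_mk, SubQuotient.mk_eq_zero] at hy
    obtain ⟨φ, hφ⟩ := mem_coboundaries.1 hy
    obtain ⟨χ, hχ⟩ := mem_coboundaries.1 (hV _ (cocycles_anti h.right_subset _ hω))
    have hmem : φ - χ ∈ cocycles (U ∩ V) i := by
      have := sub_mem (nullCochains_anti (Set.inter_subset_right : U ∩ V ⊆ V) _ hχ)
        (nullCochains_anti (Set.inter_subset_left : U ∩ V ⊆ U) _ hφ)
      rw [mem_cocycles, map_sub]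
      convert this using 1
      abel
    refine ⟨SubQuotient.mk (φ - χ) hmem, ?_⟩
    rw [connecting_mk, SubQuotient.mk_eq_mk]
    -- Up to null cochains ω is dφ on `U` and dχ on `V`, so the connecting representative minus ω is
    -- -dχ on both.
    refine mem_coboundaries.2 ⟨-χ, h.nullCochains_inf_le ?_ ?_⟩
    · have := neg_mem (add_mem (sub_cochainIndicator_mem U (i + 1) (coboundary E (φ - χ))) hφ)
      convert this using 1
      rw [map_sub, map_neg]
      abel
    · have := sub_mem (cochainIndicator_mem hmem) hχ
      convert this using 1
      rw [map_neg]
      abel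
  · rintro ⟨x, rfl⟩
    obtain ⟨φ, hφ, rfl⟩ := SubQuotient.exists_mk x
    rw [connecting_mk, cohomologyRes_mk, SubQuotient.mk_eq_zero]
    have := sub_mem (coboundary_mem_coboundaries U (i + 1) φ)
      (nullCochains_le_coboundaries U _ (sub_cochainIndicator_mem U (i + 1) (coboundary E φ)))
    rwa [sub_sub_cancel] at this

/-- `A` has finite-dimensional cohomology, with reduced Euler characteristic `χ` (up to sign). -/
def HasEulerChar (A : Set E) (χ : ℤ) : Prop :=
  (∀ i, Module.Finite ℚ (Cohomology A i)) ∧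
    (Module.finrank ℚ (Cohomology A 0) : ℤ) - Module.finrank ℚ (Cohomology A 1) = χ

theorem IsUniformCover.hasEulerChar (h : IsUniformCover X U V)
    (hV : ∀ i, cocycles V i ≤ coboundaries V i) {χ χ' : ℤ} (hU : HasEulerChar U χ)
    (hUV : HasEulerChar (U ∩ V) χ') : HasEulerChar X (χ - χ') := by
  have := hU.1
  have := hUV.1
  have key := euler_char_of_exact_hexagon (A := fun i => Cohomology X i)
    (B := fun i => Cohomology U i) (C := fun i => Cohomology (U ∩ V : Set E) i) _ _ _
    (h.exact_res_res hV) (h.exact_res_connecting hV) (h.exact_connecting_res hV)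
  exact ⟨key.1, by rw [key.2, hU.2, hUV.2]⟩

end Cohomology

/-! ### Homotopy invariance -/

open Classical in
/-- Extension of a map between subsets to a map of the ambient spaces. -/
noncomputable def extendSubtypeMap {E E' : Type*} [Nonempty E'] {A : Set E} {B : Set E'} (f : A → B) (x : E) :
    E' :=
  if h : x ∈ A then f ⟨x, h⟩ else Classical.arbitrary E'

theorem extendSubtypeMap_of_mem {E E' : Type*} [Nonempty E'] {A : Set E} {B : Set E'} (f : A → B) {x : E}
    (h : x ∈ A) : extendSubtypeMap f x = f ⟨x, h⟩ := dif_pos h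

theorem mapsTo_extendSubtypeMap {E E' : Type*} [Nonempty E'] {A : Set E} {B : Set E'} (f : A → B) :
    Set.MapsTo (extendSubtypeMap f) A B := fun x hx => by
  rw [extendSubtypeMap_of_mem f hx]; exact (f _).2

section Homotopy

open Topology Set

variable {E E' : Type*} [PseudoMetricSpace E] [PseudoMetricSpace E']

theorem cochainPullback_mem_nullCochains {f : E → E'} {A : Set E} {B : Set E'}
    (hf : UniformContinuousOn f A) (hAB : MapsTo f A B) {i : ZMod 2} {φ : List E' → ℚ}
    (hφ : φ ∈ nullCochains B i) : cochainPullback f φ ∈ nullCochains A i := by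
  obtain ⟨ε, hε, h⟩ := hφ
  obtain ⟨δ, hδ, hd⟩ := Metric.uniformContinuousOn_iff.1 hf ε hε
  refine ⟨δ, hδ, fun l hl hi => ?_⟩
  rw [cochainPullback_apply]
  refine h _ ⟨?_, ?_⟩ (by rwa [List.length_map])
  · simp only [List.mem_map, forall_exists_index, and_imp, forall_apply_eq_imp_iff₂]
    exact fun x hx => hAB (hl.1 x hx)
  · simp only [List.mem_map, forall_exists_index, and_imp, forall_apply_eq_imp_iff₂]
    exact fun x hx y hy => hd x (hl.1 x hx) y (hl.1 y hy) (hl.2 x hx y hy)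

theorem cochainPullback_mem_cocycles {f : E → E'} {A : Set E} {B : Set E'}
    (hf : UniformContinuousOn f A) (hAB : MapsTo f A B) {i : ZMod 2} {φ : List E' → ℚ}
    (hφ : φ ∈ cocycles B i) : cochainPullback f φ ∈ cocycles A i := by
  rw [mem_cocycles, coboundary_cochainPullback]
  exact cochainPullback_mem_nullCochains hf hAB hφ

theorem cochainPullback_mem_coboundaries {f : E → E'} {A : Set E} {B : Set E'}
    (hf : UniformContinuousOn f A) (hAB : MapsTo f A B) {i : ZMod 2} {φ : List E' → ℚ}
    (hφ : φ ∈ coboundaries B i) : cochainPullback f φ ∈ coboundaries A i := by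
  obtain ⟨ψ, hψ⟩ := mem_coboundaries.1 hφ
  refine mem_coboundaries.2 ⟨cochainPullback f ψ, ?_⟩
  rw [coboundary_cochainPullback, ← map_sub]
  exact cochainPullback_mem_nullCochains hf hAB hψ

theorem cochainPullback_sub_mem_nullCochains {F : Type*} {f g : E → F} {A : Set E}
    (h : EqOn f g A) (i : ZMod 2) (φ : List F → ℚ) :
    cochainPullback f φ - cochainPullback g φ ∈ nullCochains A i := by
  refine ⟨1, one_pos, fun l hl _ => ?_⟩
  rw [Pi.sub_apply, cochainPullback_apply, cochainPullback_apply,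
    List.map_congr_left fun x hx => h (hl.1 x hx), sub_self]

theorem cochainPullback_sub_mem_coboundaries_of_dist_lt {f g : E → E'} {A : Set E} {B : Set E'}
    (hf : UniformContinuousOn f A) (hfA : MapsTo f A B) (hg : UniformContinuousOn g A)
    (hgA : MapsTo g A B) {i : ZMod 2} {φ : List E' → ℚ} {ε : ℝ} (hε : 0 < ε)
    (hφ : ∀ l, IsSmallList B ε l → (l.length : ZMod 2) = i + 1 → coboundary E' φ l = 0)
    (hfg : ∀ x ∈ A, dist (f x) (g x) < ε / 2) :
    cochainPullback g φ - cochainPullback f φ ∈ coboundaries A i := by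
  -- Half of ε each: a mixed pair `f x`, `g y` is compared through `f y`.
  obtain ⟨δ, hδ, hd⟩ := Metric.uniformContinuousOn_iff.1 hf (ε / 2) (by positivity)
  obtain ⟨δ', hδ', hd'⟩ := Metric.uniformContinuousOn_iff.1 hg (ε / 2) (by positivity)
  refine mem_coboundaries.2 ⟨prism f g φ, min δ δ', lt_min hδ hδ', fun l hl hi => ?_⟩
  have key := coboundary_prism_add f g φ l
  rw [Pi.sub_apply, Pi.sub_apply, cochainPullback_apply, cochainPullback_apply, ← key,
    add_sub_cancel_left]
  have hff : ∀ x ∈ l, ∀ y ∈ l, dist (f x) (f y) < ε / 2 := fun x hx y hy =>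
    hd x (hl.1 x hx) y (hl.1 y hy) ((hl.2 x hx y hy).trans_le (min_le_left _ _))
  have hgg : ∀ x ∈ l, ∀ y ∈ l, dist (g x) (g y) < ε / 2 := fun x hx y hy =>
    hd' x (hl.1 x hx) y (hl.1 y hy) ((hl.2 x hx y hy).trans_le (min_le_right _ _))
  have hfg' : ∀ x ∈ l, ∀ y ∈ l, dist (f x) (g y) < ε := fun x hx y hy => by
    have := dist_triangle (f x) (f y) (g y)
    linarith [hff x hx y hy, hfg y (hl.1 y hy)]
  refine prism_eq_zero fun m hm hlen => hφ m ⟨?_, ?_⟩ (by rw [hlen]; push_cast; rw [hi])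
  · intro y hy
    obtain ⟨x, hx, rfl | rfl⟩ := hm y hy
    exacts [hfA (hl.1 x hx), hgA (hl.1 x hx)]
  · intro y hy z hz
    obtain ⟨x, hx, rfl | rfl⟩ := hm y hy <;> obtain ⟨w, hw, rfl | rfl⟩ := hm z hz
    · linarith [hff x hx w hw]
    · exact hfg' x hx w hw
    · rw [dist_comm]; exact hfg' w hw x hx
    · linarith [hgg x hx w hw]

/-- The maps `f`, `g` are homotopic as maps from `A` to `B`. -/
def IsHomotopicOn (A : Set E) (B : Set E') (f g : E → E') : Prop :=
  ∃ H : ℝ → E → E', ContinuousOn (fun p : ℝ × E => H p.1 p.2) (Icc 0 1 ×ˢ A) ∧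
    (∀ t ∈ Icc (0 : ℝ) 1, ∀ x ∈ A, H t x ∈ B) ∧ (∀ x ∈ A, H 0 x = f x) ∧ ∀ x ∈ A, H 1 x = g x

/-- One ε controls the whole cocycle, and by uniform continuity on the compact product the homotopy
splits into finitely many steps moving points by less than ε/2. -/
theorem IsHomotopicOn.sub_mem_coboundaries {A : Set E} {B : Set E'} {f g : E → E'}
    (h : IsHomotopicOn A B f g) (hA : IsCompact A) {i : ZMod 2} {φ : List E' → ℚ}
    (hφ : φ ∈ cocycles B i) : cochainPullback g φ - cochainPullback f φ ∈ coboundaries A i := by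
  obtain ⟨H, hH, hHB, hH0, hH1⟩ := h
  obtain ⟨ε, hε, hs⟩ := mem_nullCochains.1 (mem_cocycles.1 hφ)
  have hU := (isCompact_Icc.prod hA).uniformContinuousOn_of_continuous hH
  have hUt : ∀ t ∈ Icc (0 : ℝ) 1, UniformContinuousOn (H t) A := fun t ht =>
    hA.uniformContinuousOn_of_continuous
      (hH.comp (continuousOn_const.prodMk continuousOn_id) fun x hx => ⟨ht, hx⟩)
  obtain ⟨δ, hδ, hd⟩ := Metric.uniformContinuousOn_iff.1 hU (ε / 2) (by positivity)
  obtain ⟨n, hn⟩ := exists_nat_one_div_lt hδ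
  have hn0 : (0 : ℝ) < n + 1 := by positivity
  have hmem : ∀ j : ℕ, j ≤ n + 1 → (j : ℝ) / (n + 1) ∈ Icc (0 : ℝ) 1 := fun j hj =>
    ⟨by positivity, (div_le_one hn0).2 (by exact_mod_cast hj)⟩
  have step : ∀ j : ℕ, j ≤ n + 1 →
      cochainPullback (H (j / (n + 1))) φ - cochainPullback (H 0) φ ∈ coboundaries A i := by
    intro j
    induction j with
    | zero => simp
    | succ j ih =>
      intro hj
      have h1 := cochainPullback_sub_mem_coboundaries_of_dist_lt (hUt _ (hmem j (by omega)))
        (fun x hx => hHB _ (hmem j (by omega)) x hx) (hUt _ (hmem (j + 1) hj))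
        (fun x hx => hHB _ (hmem (j + 1) hj) x hx) hε hs fun x hx => ?_
      · have := add_mem h1 (ih (by omega))
        rwa [sub_add_sub_cancel] at this
      · refine hd (_, x) ⟨hmem j (by omega), hx⟩ (_, x) ⟨hmem (j + 1) hj, hx⟩ ?_
        rw [Prod.dist_eq, dist_self, max_eq_left dist_nonneg, Real.dist_eq, ← sub_div]
        push_cast
        rw [sub_add_cancel_left, abs_div, abs_neg, abs_one, abs_of_pos hn0]
        exact hn
  have h1 := step (n + 1) le_rfl
  rw [show ((n + 1 : ℕ) : ℝ) / (n + 1) = 1 by push_cast; exact div_self hn0.ne'] at h1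
  have e0 := nullCochains_le_coboundaries A i
    (cochainPullback_sub_mem_nullCochains (f := H 0) (g := f) hH0 i φ)
  have e1 := nullCochains_le_coboundaries A i
    (cochainPullback_sub_mem_nullCochains (f := H 1) (g := g) hH1 i φ)
  have := sub_mem (add_mem h1 e0) e1
  convert this using 1
  abel

/-- The identity may be replaced by the constant map. For its pullback ψ, prefixing `c` is a cone
operator: the error term is dφ on a constant list, which is ε-small for every ε > 0. -/
theorem IsHomotopicOn.cocycles_le_coboundaries {A : Set E} {c : E} (hc : c ∈ A)
    (h : IsHomotopicOn A A (fun _ => c) id) (hA : IsCompact A) (i : ZMod 2) :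
    cocycles A i ≤ coboundaries A i := by
  intro φ hφ
  have h1 := h.sub_mem_coboundaries hA hφ
  obtain ⟨ε, hε, hs⟩ := mem_nullCochains.1 (mem_cocycles.1 hφ)
  have h2 : cochainPullback (fun _ : E => c) φ ∈ coboundaries A i := by
    set ψ := cochainPullback (fun _ : E => c) φ with hψ
    refine mem_coboundaries.2 ⟨fun m => ψ (c :: m), ε, hε, fun l hl hi => ?_⟩
    rw [Pi.sub_apply, ← coboundary_cons, hψ, coboundary_cochainPullback, cochainPullback_apply]
    refine hs _ ⟨?_, ?_⟩ (by simp [hi])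
    · simp [hc]
    · intro x hx y hy
      simp only [List.mem_map] at hx hy
      obtain ⟨_, _, rfl⟩ := hx
      obtain ⟨_, _, rfl⟩ := hy
      rwa [dist_self]
  have := add_mem h1 h2
  rw [sub_add_cancel] at this
  convert this using 1
  funext l
  simp

/-- The map induced in cohomology. -/
def cohomologyMap {f : E → E'} {A : Set E} {B : Set E'} (hf : UniformContinuousOn f A)
    (hAB : MapsTo f A B) (i : ZMod 2) : Cohomology B i →ₗ[ℚ] Cohomology A i :=
  SubQuotient.map (cochainPullback f) (fun _ hz => cochainPullback_mem_cocycles hf hAB hz)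
    fun _ hz => cochainPullback_mem_coboundaries hf hAB hz

theorem cohomologyMap_comp_eq_id {f : E → E'} {g : E' → E} {A : Set E} {B : Set E'}
    (hA : IsCompact A) (hf : UniformContinuousOn f A) (hfA : MapsTo f A B)
    (hg : UniformContinuousOn g B) (hgB : MapsTo g B A) (h : IsHomotopicOn A A (g ∘ f) id)
    (i : ZMod 2) : cohomologyMap hf hfA i ∘ₗ cohomologyMap hg hgB i = LinearMap.id := by
  refine LinearMap.ext fun x => ?_
  obtain ⟨φ, hφ, rfl⟩ := SubQuotient.exists_mk x
  simp only [LinearMap.comp_apply, cohomologyMap, SubQuotient.map_mk, LinearMap.id_apply]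
  rw [SubQuotient.mk_eq_mk]
  have := neg_mem (h.sub_mem_coboundaries hA hφ)
  convert this using 1
  funext l
  simp

theorem HasEulerChar.of_homotopyEquiv {f : E → E'} {g : E' → E} {A : Set E} {B : Set E'}
    (hA : IsCompact A) (hB : IsCompact B) (hf : ContinuousOn f A) (hfA : MapsTo f A B)
    (hg : ContinuousOn g B) (hgB : MapsTo g B A) (h : IsHomotopicOn A A (g ∘ f) id)
    (h' : IsHomotopicOn B B (f ∘ g) id) {χ : ℤ} (hχ : HasEulerChar A χ) : HasEulerChar B χ := by
  have hf' := hA.uniformContinuousOn_of_continuous hf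
  have hg' := hB.uniformContinuousOn_of_continuous hg
  let e : ∀ i, Cohomology A i ≃ₗ[ℚ] Cohomology B i := fun i =>
    LinearEquiv.ofLinearMap (cohomologyMap hg' hgB i) (cohomologyMap hf' hfA i)
      (cohomologyMap_comp_eq_id hB hg' hgB hf' hfA h' i)
      (cohomologyMap_comp_eq_id hA hf' hfA hg' hgB h i)
  refine ⟨fun i => ?_, ?_⟩
  · have := hχ.1 i
    exact Module.Finite.equiv (e i)
  · rw [← (e 0).finrank_eq, ← (e 1).finrank_eq, hχ.2]

theorem HasEulerChar.unique {A : Set E} {χ χ' : ℤ} (h : HasEulerChar A χ)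
    (h' : HasEulerChar A χ') : χ = χ' := h.2.symm.trans h'.2

theorem continuousOn_extendSubtypeMap [Nonempty E'] {A : Set E} {B : Set E'} {f : A → B}
    (hf : Continuous f) : ContinuousOn (extendSubtypeMap f) A := by
  rw [continuousOn_iff_continuous_domRestrict]
  convert continuous_subtype_val.comp hf using 1
  funext x
  exact extendSubtypeMap_of_mem f x.2

theorem isHomotopicOn_of_homotopic [Nonempty E'] {A : Set E} {B : Set E'} {f g : C(A, B)}
    (h : f.Homotopic g) : IsHomotopicOn A B (extendSubtypeMap f) (extendSubtypeMap g) := by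
  obtain ⟨H⟩ := h
  let H' : (Icc (0 : ℝ) 1 ×ˢ A : Set (ℝ × E)) → B :=
    fun p => H (⟨p.1.1, p.2.1⟩, ⟨p.1.2, p.2.2⟩)
  have hH' : Continuous H' := by fun_prop
  refine ⟨fun t x => extendSubtypeMap H' (t, x), continuousOn_extendSubtypeMap hH',
    fun t ht x hx => mapsTo_extendSubtypeMap H' ⟨ht, hx⟩, fun x hx => ?_, fun x hx => ?_⟩
  · have hm : ((0 : ℝ), x) ∈ (Icc (0 : ℝ) 1 ×ˢ A : Set (ℝ × E)) := ⟨by simp, hx⟩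
    dsimp only
    rw [extendSubtypeMap_of_mem _ hm, extendSubtypeMap_of_mem _ hx]
    exact congrArg _ (H.apply_zero ⟨x, hx⟩)
  · have hm : ((1 : ℝ), x) ∈ (Icc (0 : ℝ) 1 ×ˢ A : Set (ℝ × E)) := ⟨by simp, hx⟩
    dsimp only
    rw [extendSubtypeMap_of_mem _ hm, extendSubtypeMap_of_mem _ hx]
    exact congrArg _ (H.apply_one ⟨x, hx⟩)

theorem IsHomotopicOn.congr {A : Set E} {B : Set E'} {f g f' g' : E → E'}
    (h : IsHomotopicOn A B f g) (hf : EqOn f f' A) (hg : EqOn g g' A) :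
    IsHomotopicOn A B f' g' := by
  obtain ⟨H, h1, h2, h3, h4⟩ := h
  exact ⟨H, h1, h2, fun x hx => (h3 x hx).trans (hf hx), fun x hx => (h4 x hx).trans (hg hx)⟩

theorem HasEulerChar.congr_homotopyEquiv [Nonempty E] [Nonempty E'] {A : Set E} {B : Set E'}
    (hA : IsCompact A) (hB : IsCompact B) (e : ContinuousMap.HomotopyEquiv A B) {χ : ℤ}
    (hχ : HasEulerChar A χ) : HasEulerChar B χ := by
  refine HasEulerChar.of_homotopyEquiv hA hB (continuousOn_extendSubtypeMap e.toFun.continuous)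
    (mapsTo_extendSubtypeMap _) (continuousOn_extendSubtypeMap e.invFun.continuous)
    (mapsTo_extendSubtypeMap _) ?_ ?_ hχ
  · refine (isHomotopicOn_of_homotopic e.left_inv).congr (fun x hx => ?_) fun x hx => ?_
    · rw [Function.comp_apply, extendSubtypeMap_of_mem _ hx, extendSubtypeMap_of_mem _ hx,
        extendSubtypeMap_of_mem _ (Subtype.coe_prop _)]
      rfl
    · rw [extendSubtypeMap_of_mem _ hx]; rfl
  · refine (isHomotopicOn_of_homotopic e.right_inv).congr (fun x hx => ?_) fun x hx => ?_
    · rw [Function.comp_apply, extendSubtypeMap_of_mem _ hx, extendSubtypeMap_of_mem _ hx,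
        extendSubtypeMap_of_mem _ (Subtype.coe_prop _)]
      rfl
    · rw [extendSubtypeMap_of_mem _ hx]; rfl

end Homotopy

/-! ### Geometry of a simplex -/

section Simplex

open Set

variable {V : Type*} [NormedAddCommGroup V] [NormedSpace ℝ V]

theorem exists_continuous_barycentric_coord [FiniteDimensional ℝ V] {σ : Finset V}
    (hσ : AffineIndependent ℝ ((↑) : σ → V)) :
    ∃ b : V → V → ℝ, (∀ v, Continuous (b v)) ∧
      ∀ w : V → ℝ, ∑ y ∈ σ, w y = 1 → ∀ v ∈ σ, b v (∑ y ∈ σ, w y • y) = w v := by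
  classical
  -- Completing σ to an affine basis makes its barycentric coordinates affine functions on all of
  -- `V`.
  obtain ⟨t, hσt, ht, htop⟩ :=
    exists_subset_affineIndependent_affineSpan_eq_top (s := (σ : Set V)) hσ
  let B : AffineBasis t ℝ V := ⟨_, ht, by rw [Subtype.range_coe]; exact htop⟩
  refine ⟨fun v => if h : v ∈ t then B.coord ⟨v, h⟩ else 0, fun v => ?_, fun w hw v hv => ?_⟩
  · by_cases h : v ∈ t
    · simp only [h, dif_pos]
      exact AffineMap.continuous_of_finiteDimensional _
    · simp only [h, dif_neg, not_false_eq_true]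
      exact continuous_const
  · have hvt : v ∈ t := hσt hv
    simp only [hvt, dif_pos]
    set f := B.coord ⟨v, hvt⟩ with hf
    have hfy : ∀ y ∈ σ, f y = if v = y then 1 else 0 := fun y hy => by
      have := B.coord_apply ⟨v, hvt⟩ ⟨y, hσt hy⟩
      simp only [Subtype.mk.injEq] at this
      exact this
    have h1 : ∀ x, f x = f.linear x + f 0 := fun x => congrFun f.decomp x
    have h2 : f (∑ y ∈ σ, w y • y) = ∑ y ∈ σ, w y * f y := by
      have h3 : ∑ y ∈ σ, w y * f y = ∑ y ∈ σ, (w y * f.linear y + w y * f 0) :=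
        Finset.sum_congr rfl fun y _ => by rw [h1 y, mul_add]
      rw [h3, h1, map_sum, Finset.sum_add_distrib, ← Finset.sum_mul, hw, one_mul]
      simp only [map_smul, smul_eq_mul]
    rw [h2, Finset.sum_congr rfl fun y hy => by rw [hfy y hy]]
    simp [hv]

/-- Radial deformation of the simplex with vertex set `σ` at time `t`, away from the barycentre;
here `a` stands for the minimal barycentric coordinate of the point `x`. -/
noncomputable def radial (σ : Finset V) (t a : ℝ) (x : V) : V :=
  (1 - t * (σ.card * a))⁻¹ • (x - (t * a) • ∑ v ∈ σ, v)

theorem radial_zero_right (σ : Finset V) (t : ℝ) (x : V) : radial σ t 0 x = x := by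
  simp [radial]

theorem radial_zero_left (σ : Finset V) (a : ℝ) (x : V) : radial σ 0 a x = x := by
  simp [radial]

open Classical in
-- Let `m` be the minimal barycentric coordinate: it vanishes exactly on the boundary. `radial`
-- subtracts `t * m x` from every coordinate and renormalises, so at `t = 1` it projects radially
-- onto the boundary; this is undefined only where `σ.card * m x = 1`, at the barycentre.
theorem exists_min_barycentric_coord [FiniteDimensional ℝ V] {σ : Finset V}
    (hσ : AffineIndependent ℝ ((↑) : σ → V)) (hne : σ.Nonempty) :
    ∃ m : V → ℝ, Continuous m ∧
      (∀ x ∈ convexHull ℝ (σ : Set V), 0 ≤ m x ∧ σ.card * m x ≤ 1) ∧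
      (∀ x ∈ convexHull ℝ (σ : Set V),
        m x = 0 ↔ ∃ v ∈ σ, x ∈ convexHull ℝ (σ.erase v : Set V)) ∧
      ∀ x ∈ convexHull ℝ (σ : Set V), ∀ t ∈ Icc (0 : ℝ) 1, t * (σ.card * m x) < 1 →
        radial σ t (m x) x ∈ convexHull ℝ (σ : Set V) ∧
          m (radial σ t (m x) x) ≤ (1 - t * (σ.card * m x))⁻¹ * ((1 - t) * m x) := by
  obtain ⟨b, hbc, hb⟩ := exists_continuous_barycentric_coord hσ
  have hm : ∀ x, ∀ v ∈ σ, σ.inf' hne (fun v => b v x) ≤ b v x := fun x v hv =>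
    Finset.inf'_le (fun v => b v x) hv
  refine ⟨fun x => σ.inf' hne fun v => b v x,
    Continuous.finset_inf'_apply hne fun v _ => hbc v, ?_, ?_, ?_⟩
  · intro x hx
    obtain ⟨w, hw0, hw1, rfl⟩ := Finset.mem_convexHull'.1 hx
    refine ⟨Finset.le_inf' _ _ fun v hv => ?_, ?_⟩
    · rw [hb w hw1 v hv]; exact hw0 v hv
    · rw [← nsmul_eq_mul, ← hw1]
      refine Finset.card_nsmul_le_sum _ _ _ fun v hv => ?_
      exact (hm _ v hv).trans_eq (hb w hw1 v hv)
  · intro x hx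
    constructor
    · intro h0
      obtain ⟨w, hw0, hw1, rfl⟩ := Finset.mem_convexHull'.1 hx
      obtain ⟨v, hv, hv'⟩ := Finset.exists_mem_eq_inf' hne fun v => b v (∑ y ∈ σ, w y • y)
      dsimp only at h0
      rw [hv', hb w hw1 v hv] at h0
      refine ⟨v, hv, ?_⟩
      rw [Finset.mem_convexHull']
      refine ⟨w, fun y hy => hw0 y (Finset.mem_of_mem_erase hy), ?_, ?_⟩
      · rw [← hw1, ← Finset.add_sum_erase _ _ hv, h0, zero_add]
      · rw [← Finset.add_sum_erase _ _ hv, h0, zero_smul, zero_add]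
    · rintro ⟨v, hv, hx'⟩
      rw [Finset.mem_convexHull'] at hx'
      obtain ⟨w, hw0, hw1, rfl⟩ := hx'
      -- The weights of a point of a facet, extended by zero to the missing vertex.
      set w' : V → ℝ := fun y => if y = v then 0 else w y with hw'
      have e1 : ∑ y ∈ σ, w' y = 1 := by
        rw [← Finset.add_sum_erase _ _ hv, ← hw1]
        simp only [hw', if_true, zero_add]
        exact Finset.sum_congr rfl fun y hy => if_neg (Finset.ne_of_mem_erase hy)
      have e2 : ∑ y ∈ σ, w' y • y = ∑ y ∈ σ.erase v, w y • y := by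
        rw [← Finset.add_sum_erase _ _ hv]
        simp only [hw', if_true, zero_smul, zero_add]
        exact Finset.sum_congr rfl fun y hy => by rw [if_neg (Finset.ne_of_mem_erase hy)]
      rw [← e2]
      refine le_antisymm ((hm _ v hv).trans_eq ?_) (Finset.le_inf' _ _ fun y hy => ?_)
      · rw [hb w' e1 v hv]; simp [hw']
      · rw [hb w' e1 y hy]
        simp only [hw']
        split_ifs with h
        · exact le_rfl
        · exact hw0 y (Finset.mem_erase.2 ⟨h, hy⟩)
  · intro x hx t ht hlt
    obtain ⟨w, hw0, hw1, rfl⟩ := Finset.mem_convexHull'.1 hx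
    obtain ⟨v, hv, hv'⟩ := Finset.exists_mem_eq_inf' hne fun v => b v (∑ y ∈ σ, w y • y)
    dsimp only at hlt ⊢
    have hmw : ∀ y ∈ σ, σ.inf' hne (fun v => b v (∑ y ∈ σ, w y • y)) ≤ w y := fun y hy =>
      (hm _ y hy).trans_eq (hb w hw1 y hy)
    rw [hv', hb w hw1 v hv] at hlt hmw ⊢
    set c := (1 - t * (σ.card * w v))⁻¹ with hc
    have hc0 : 0 < 1 - t * (σ.card * w v) := by linarith
    set w' : V → ℝ := fun y => c * (w y - t * w v) with hw'
    have e1 : ∑ y ∈ σ, w' y = 1 := by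
      rw [← Finset.mul_sum, Finset.sum_sub_distrib, hw1, Finset.sum_const, nsmul_eq_mul,
        show (σ.card : ℝ) * (t * w v) = t * (σ.card * w v) by ring, hc, inv_mul_cancel₀ hc0.ne']
    have e2 : radial σ t (w v) (∑ y ∈ σ, w y • y) = ∑ y ∈ σ, w' y • y := by
      rw [radial, Finset.smul_sum, ← Finset.sum_sub_distrib, Finset.smul_sum]
      exact Finset.sum_congr rfl fun y _ => by rw [hw', ← sub_smul, smul_smul]
    rw [e2]
    refine ⟨Finset.mem_convexHull'.2 ⟨w', fun y hy => ?_, e1, rfl⟩, (hm _ v hv).trans_eq ?_⟩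
    · refine mul_nonneg (inv_nonneg.2 hc0.le) (sub_nonneg.2 ?_)
      exact (mul_le_of_le_one_left (hw0 v hv) ht.2).trans (hmw y hy)
    · rw [hb w' e1 v hv]
      simp only [hw']
      ring

end Simplex

/-! ### The Euler characteristic of a polyhedron -/

section Polyhedron

open Set Finset

/-- Time runs backwards: `H 0` is the retraction and `H 1` the identity. -/
theorem HasEulerChar.of_deformationRetract {E : Type*} [PseudoMetricSpace E] {A U : Set E}
    (hA : IsCompact A) (hU : IsCompact U) (hAU : A ⊆ U) {H : ℝ → E → E}
    (hH : ContinuousOn (fun p : ℝ × E => H p.1 p.2) (Set.Icc 0 1 ×ˢ U))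
    (hHU : ∀ t ∈ Set.Icc (0 : ℝ) 1, ∀ x ∈ U, H t x ∈ U) (h0 : ∀ x ∈ U, H 0 x ∈ A)
    (h0A : ∀ x ∈ A, H 0 x = x) (h1 : ∀ x ∈ U, H 1 x = x) {χ : ℤ} (hχ : HasEulerChar A χ) :
    HasEulerChar U χ := by
  refine hχ.of_homotopyEquiv (f := id) (g := H 0) hA hU continuousOn_id (fun x hx => hAU hx)
    (hH.comp (continuousOn_const.prodMk continuousOn_id) fun x hx => ⟨by simp, hx⟩)
    (fun x hx => h0 x hx) ?_ ⟨H, hH, hHU, fun _ _ => rfl, h1⟩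
  exact ⟨fun _ x => x, continuousOn_snd, fun _ _ _ hx => hx, fun x hx => (h0A x hx).symm,
    fun _ _ => rfl⟩

/-- Only the empty list lies in ∅, so the cohomology is ℚ in even degree and zero in odd degree. -/
theorem hasEulerChar_empty (E : Type*) [PseudoMetricSpace E] : HasEulerChar (∅ : Set E) 1 := by
  have hsmall : ∀ {ε : ℝ} {l : List E}, IsSmallList ∅ ε l → l = [] := fun hl =>
    List.eq_nil_iff_forall_not_mem.2 fun x hx => hl.1 x hx
  have hcoc : ∀ i, cocycles (∅ : Set E) i = ⊤ := fun i => by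
    refine eq_top_iff.2 fun φ _ => ⟨1, one_pos, fun l hl _ => ?_⟩
    rw [hsmall hl, coboundary_nil]
  have hB1 : cocycles (∅ : Set E) 1 ≤ coboundaries ∅ 1 := fun φ _ => by
    refine nullCochains_le_coboundaries _ _ ⟨1, one_pos, fun l hl hi => ?_⟩
    rw [hsmall hl] at hi
    simp at hi
  have hB0 : ∀ φ : List E → ℚ, φ ∈ coboundaries (∅ : Set E) 0 ↔ φ [] = 0 := fun φ => by
    rw [mem_coboundaries]
    constructor
    · rintro ⟨ψ, ε, hε, h⟩
      simpa using h [] ⟨by simp, by simp⟩ (by simp)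
    · intro h
      exact ⟨0, 1, one_pos, fun l hl _ => by rw [hsmall hl]; simp [h]⟩
  let ev : cocycles (∅ : Set E) 0 →ₗ[ℚ] ℚ :=
    (LinearMap.proj (R := ℚ) (φ := fun _ : List E => ℚ) []).comp (Submodule.subtype _)
  have hev : Function.Surjective ev := fun c => ⟨⟨fun _ => c, by rw [hcoc]; trivial⟩, rfl⟩
  have hker : (coboundaries (∅ : Set E) 0).submoduleOf (cocycles ∅ 0) = ev.ker := by
    ext φ
    exact hB0 φ.1
  let e0 : Cohomology (∅ : Set E) 0 ≃ₗ[ℚ] ℚ :=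
    (Submodule.quotEquivOfEq _ _ hker).trans (ev.quotKerEquivOfSurjective hev)
  have h1 : Subsingleton (Cohomology (∅ : Set E) 1) := by
    refine subsingleton_of_forall_eq 0 fun x => ?_
    obtain ⟨φ, hφ, rfl⟩ := SubQuotient.exists_mk x
    exact SubQuotient.mk_eq_zero.2 (hB1 hφ)
  refine ⟨fun i => ?_, ?_⟩
  · fin_cases i
    · exact Module.Finite.equiv e0.symm
    · exact (inferInstance : Module.Finite ℚ (Cohomology (∅ : Set E) 1))
  · rw [e0.finrank_eq, Module.finrank_self, Module.finrank_zero_of_subsingleton]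
    simp

variable {V : Type*} [NormedAddCommGroup V] [NormedSpace ℝ V]

theorem Convex.cocycles_le_coboundaries {A : Set V} (hA : Convex ℝ A) (hne : A.Nonempty)
    (hc : IsCompact A) (i : ZMod 2) : cocycles A i ≤ coboundaries A i := by
  obtain ⟨c, hcA⟩ := hne
  refine IsHomotopicOn.cocycles_le_coboundaries hcA ⟨fun t x => (1 - t) • c + t • x, ?_, ?_, ?_, ?_⟩
    hc i
  · fun_prop
  · intro t ht x hx
    exact hA hcA hx (by linarith [ht.2]) ht.1 (by ring)
  · simp
  · simp

/-- The conditions defining a simplicial complex, for a finite set of finite sets of points. -/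
structure IsSimplicialComplex (T : Finset (Finset V)) : Prop where
  nonempty : ∀ s ∈ T, s.Nonempty
  down_closed : ∀ s ∈ T, ∀ t ⊆ s, t.Nonempty → t ∈ T
  indep : ∀ s ∈ T, AffineIndependent ℝ ((↑) : s → V)
  inter_subset : ∀ s ∈ T, ∀ t ∈ T,
    convexHull ℝ (s : Set V) ∩ convexHull ℝ (t : Set V) ⊆ convexHull ℝ (s ∩ t : Set V)

/-- The union of the simplices. -/
def realization (T : Finset (Finset V)) : Set V := ⋃ s ∈ T, convexHull ℝ (s : Set V)

theorem mem_realization {T : Finset (Finset V)} {x : V} :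
    x ∈ realization T ↔ ∃ s ∈ T, x ∈ convexHull ℝ (s : Set V) := by
  simp [realization]

theorem isCompact_realization (T : Finset (Finset V)) : IsCompact (realization T) :=
  T.finite_toSet.isCompact_biUnion fun s _ => s.finite_toSet.isCompact_convexHull ℝ

theorem realization_mono {T T' : Finset (Finset V)} (h : T ⊆ T') :
    realization T ⊆ realization T' := biUnion_subset_biUnion_left h

end Polyhedron

/-! ### Removing a simplex of maximal dimension -/

section Induction

open Set Finset

open Classical in
/-- The set of proper non-empty faces of a simplex. -/
noncomputable def properFaces {α : Type*} (σ : Finset α) : Finset (Finset α) :=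
  (σ.powerset.erase ∅).erase σ

theorem mem_properFaces {α : Type*} {σ s : Finset α} : s ∈ properFaces σ ↔ s ⊂ σ ∧ s.Nonempty := by
  classical
  rw [properFaces, Finset.mem_erase, Finset.mem_erase, Finset.mem_powerset,
    Finset.ssubset_iff_subset_ne, Finset.nonempty_iff_ne_empty]
  tauto

variable {V : Type*} [NormedAddCommGroup V] [NormedSpace ℝ V] [FiniteDimensional ℝ V]

open Classical in
omit [FiniteDimensional ℝ V] in
theorem mem_realization_properFaces {σ : Finset V} {x : V} :
    x ∈ realization (properFaces σ) ↔ ∃ v ∈ σ, x ∈ convexHull ℝ (σ.erase v : Set V) := by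
  rw [mem_realization]
  constructor
  · rintro ⟨s, hs, hx⟩
    obtain ⟨hsσ, -⟩ := mem_properFaces.1 hs
    obtain ⟨v, hv, hvs⟩ := Finset.exists_of_ssubset hsσ
    refine ⟨v, hv, convexHull_mono (fun y hy => ?_) hx⟩
    exact Finset.mem_erase.2 ⟨fun h => hvs (h ▸ hy), hsσ.1 hy⟩
  · rintro ⟨v, hv, hx⟩
    refine ⟨σ.erase v, mem_properFaces.2 ⟨Finset.erase_ssubset hv, ?_⟩, hx⟩
    rw [← Finset.coe_nonempty, ← convexHull_nonempty_iff (𝕜 := ℝ)]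
    exact ⟨x, hx⟩

open Classical in
theorem IsSimplicialComplex.hasEulerChar_of_erase {T : Finset (Finset V)}
    (hT : IsSimplicialComplex T) {σ : Finset V} (hσ : σ ∈ T) (hmax : ∀ s ∈ T, s.card ≤ σ.card)
    {χ χ' : ℤ} (hF : HasEulerChar (realization (T.erase σ)) χ)
    (hD : HasEulerChar (realization (properFaces σ)) χ') :
    HasEulerChar (realization T) (χ - χ') := by
  obtain ⟨m, hmc, hm, hm0, hmr⟩ := exists_min_barycentric_coord (hT.indep σ hσ) (hT.nonempty σ hσ)
  set S : Set V := convexHull ℝ (σ : Set V) with hS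
  set X := realization T with hX
  set F := realization (T.erase σ) with hFdef
  set D := realization (properFaces σ) with hDdef
  have hSX : S ⊆ X := fun x hx => mem_realization.2 ⟨σ, hσ, hx⟩
  have hFX : F ⊆ X := realization_mono (Finset.erase_subset _ _)
  have hXFS : X ⊆ F ∪ S := fun x hx => by
    obtain ⟨s, hs, hxs⟩ := mem_realization.1 hx
    by_cases h : s = σ
    · exact Or.inr (by rwa [h] at hxs)
    · exact Or.inl (mem_realization.2 ⟨s, Finset.mem_erase.2 ⟨h, hs⟩, hxs⟩)
  have hDF : D ⊆ F := realization_mono fun s hs => by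
    obtain ⟨h1, h2⟩ := mem_properFaces.1 hs
    exact Finset.mem_erase.2 ⟨h1.ne, hT.down_closed σ hσ s h1.1 h2⟩
  have hDS : ∀ x, x ∈ D ↔ x ∈ S ∧ m x = 0 := fun x => by
    rw [hDdef, mem_realization_properFaces]
    constructor
    · rintro ⟨v, hv, hx⟩
      have hxS : x ∈ S := convexHull_mono (Finset.coe_subset.2 (Finset.erase_subset _ _)) hx
      exact ⟨hxS, (hm0 x hxS).2 ⟨v, hv, hx⟩⟩
    · rintro ⟨hx, h⟩
      exact (hm0 x hx).1 h
  have hFS : ∀ x ∈ F, x ∈ S → m x = 0 := by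
    intro x hxF hxS
    obtain ⟨s, hs, hxs⟩ := mem_realization.1 hxF
    obtain ⟨hne, hs⟩ := Finset.mem_erase.1 hs
    have hx := hT.inter_subset s hs σ hσ ⟨hxs, hxS⟩
    have hnot : ¬ σ ⊆ s := fun h => hne (Finset.eq_of_subset_of_card_le h (hmax s hs)).symm
    obtain ⟨v, hv, hvs⟩ := Finset.not_subset.1 hnot
    refine (hm0 x hxS).2 ⟨v, hv, convexHull_mono (fun y hy => ?_) hx⟩
    exact Finset.mem_erase.2 ⟨fun h => hvs (h ▸ hy.1), hy.2⟩
  -- Extension of `m` by zero off σ, continuous because `m` vanishes where the closed sets `F` and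
  -- `S` meet.
  set M : V → ℝ := fun x => if x ∈ S then m x else 0 with hMdef
  have hMS : ∀ x ∈ S, M x = m x := fun x hx => if_pos hx
  have hMF : ∀ x ∈ F, M x = 0 := fun x hx => by
    by_cases h : x ∈ S
    · rw [hMS x h, hFS x hx h]
    · exact if_neg h
  have hMnS : ∀ x, x ∉ S → M x = 0 := fun x hx => if_neg hx
  have hScomp : IsCompact S := σ.finite_toSet.isCompact_convexHull ℝ
  have hFcomp : IsCompact F := isCompact_realization _
  have hXcomp : IsCompact X := isCompact_realization _
  have hMc : ContinuousOn M X := by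
    refine ContinuousOn.mono (ContinuousOn.union_of_isClosed ?_ ?_ hFcomp.isClosed
      hScomp.isClosed) hXFS
    · exact continuousOn_const.congr hMF
    · exact hmc.continuousOn.congr hMS
  set k : ℝ := (σ.card : ℝ) with hk
  have hk0 : 0 < k := by
    rw [hk]; exact_mod_cast (hT.nonempty σ hσ).card_pos
  -- `k * M` is at most 1, with value 1 at the barycentre of σ; the cutoff 1/2 keeps the
  -- denominators of `radial` positive.
  set U : Set V := {x ∈ X | k * M x ≤ 1 / 2} with hU
  have hUcomp : IsCompact U := by
    refine hXcomp.of_isClosed_subset ?_ fun x hx => hx.1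
    exact (continuousOn_const.mul hMc).preimage_isClosed_of_isClosed hXcomp.isClosed
      (isClosed_Iic (a := (1 / 2 : ℝ)))
  have hUScomp : IsCompact (U ∩ S) := hUcomp.inter_right hScomp.isClosed
  have hFU : F ⊆ U := fun x hx => ⟨hFX hx, by rw [hMF x hx]; norm_num⟩
  have hDU : D ⊆ U ∩ S := fun x hx => ⟨hFU (hDF hx), ((hDS x).1 hx).1⟩
  have hcover : IsUniformCover X U S := by
    refine ⟨fun x hx => hx.1, hSX, ?_⟩
    -- A point outside `U` has `M > 1 / (2 * k)` and a point outside `S` has `M = 0`, so no δ-small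
    -- list contains both.
    obtain ⟨δ, hδ, hd⟩ := Metric.uniformContinuousOn_iff.1
      (hXcomp.uniformContinuousOn_of_continuous hMc) (1 / (2 * k)) (by positivity)
    refine ⟨δ, hδ, fun l hl => or_iff_not_imp_left.2 fun hnot y hy => ?_⟩
    push Not at hnot
    obtain ⟨x, hx, hxU⟩ := hnot
    by_contra hyS
    refine hxU ⟨hl.1 x hx, ?_⟩
    have h1 := hd x (hl.1 x hx) y (hl.1 y hy) (hl.2 x hx y hy)
    rw [hMnS y hyS, Real.dist_eq, sub_zero] at h1
    have h2 := (lt_div_iff₀ (by positivity)).1 ((le_abs_self _).trans_lt h1)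
    linarith
  set H : ℝ → V → V := fun t x => radial σ (1 - t) (M x) x with hHdef
  have hMnn : ∀ x, 0 ≤ M x := fun x => by
    by_cases h : x ∈ S
    · rw [hMS x h]; exact (hm x h).1
    · rw [hMnS x h]
  have hlt : ∀ t ∈ Set.Icc (0 : ℝ) 1, ∀ x ∈ U, (1 - t) * (k * M x) < 1 := fun t ht x hx => by
    have h1 : 0 ≤ k * M x := mul_nonneg hk0.le (hMnn x)
    have h2 := hx.2
    nlinarith [ht.1, ht.2]
  have hHc : ContinuousOn (fun p : ℝ × V => H p.1 p.2) (Set.Icc 0 1 ×ˢ U) := by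
    have hM2 : ContinuousOn (fun p : ℝ × V => M p.2) (Set.Icc 0 1 ×ˢ U) :=
      hMc.comp continuousOn_snd fun p hp => hp.2.1
    have hs : ContinuousOn (fun p : ℝ × V => 1 - p.1) (Set.Icc 0 1 ×ˢ U) := by fun_prop
    refine ContinuousOn.smul (ContinuousOn.inv₀ ?_ fun p hp => ?_) ?_
    · exact continuousOn_const.sub (hs.mul (continuousOn_const.mul hM2))
    · exact (sub_pos.2 (hlt p.1 hp.1 p.2 hp.2)).ne'
    · exact continuousOn_snd.sub ((hs.mul hM2).smul continuousOn_const)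
  have hHS : ∀ t ∈ Set.Icc (0 : ℝ) 1, ∀ x ∈ U ∩ S, H t x ∈ U ∩ S := fun t ht x hx => by
    have ht' : 1 - t ∈ Set.Icc (0 : ℝ) 1 := ⟨by linarith [ht.2], by linarith [ht.1]⟩
    have hl := hlt t ht x hx.1
    have hMx := hMS x hx.2
    have hxU := hx.1.2
    have hnn := (hm x hx.2).1
    simp only [hHdef]
    rw [hMx] at hl hxU ⊢
    obtain ⟨h1, h2⟩ := hmr x hx.2 (1 - t) ht' hl
    refine ⟨⟨hSX h1, ?_⟩, h1⟩
    rw [hMS _ h1]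
    -- The deformation does not increase the minimal coordinate, since `k * m x ≤ 1`; hence it
    -- preserves `U`.
    have h3 : (1 - (1 - t) * (k * m x))⁻¹ * ((1 - (1 - t)) * m x) ≤ m x := by
      rw [inv_mul_le_iff₀ (by linarith)]
      have : 0 ≤ (1 - t) * m x * (1 - k * m x) :=
        mul_nonneg (mul_nonneg ht'.1 hnn) (by linarith)
      nlinarith
    exact (mul_le_mul_of_nonneg_left (h2.trans h3) hk0.le).trans hxU
  have hH0S : ∀ x ∈ U ∩ S, H 0 x ∈ D := fun x hx => by
    have hl := hlt 0 (by simp) x hx.1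
    have hMx := hMS x hx.2
    simp only [hHdef]
    rw [hMx] at hl ⊢
    obtain ⟨h1, h2⟩ := hmr x hx.2 (1 - 0) (by simp) hl
    refine (hDS _).2 ⟨h1, le_antisymm (h2.trans_eq (by simp)) (hm _ h1).1⟩
  have hHn : ∀ t x, M x = 0 → H t x = x := fun t x hx => by
    simp only [hHdef]
    rw [hx, radial_zero_right]
  have hH1 : ∀ x, H 1 x = x := fun x => by
    simp only [hHdef]
    rw [sub_self, radial_zero_left]
  have hUF : ∀ x ∈ U, x ∉ S → x ∈ F := fun x hx hxS => (hXFS hx.1).resolve_right hxS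
  have hUχ : HasEulerChar U χ := by
    refine HasEulerChar.of_deformationRetract hFcomp hUcomp hFU hHc (fun t ht x hx => ?_)
      (fun x hx => ?_) (fun x hx => hHn 0 x (hMF x hx)) (fun x _ => hH1 x) hF
    · by_cases hxS : x ∈ S
      · exact (hHS t ht x ⟨hx, hxS⟩).1
      · rwa [hHn t x (hMnS x hxS)]
    · by_cases hxS : x ∈ S
      · exact hDF (hH0S x ⟨hx, hxS⟩)
      · rw [hHn 0 x (hMnS x hxS)]
        exact hUF x hx hxS
  have hUSχ : HasEulerChar (U ∩ S) χ' :=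
    HasEulerChar.of_deformationRetract (isCompact_realization _) hUScomp hDU
      (hHc.mono (Set.prod_mono le_rfl Set.inter_subset_left)) hHS hH0S
      (fun x hx => hHn 0 x (hMF x (hDF hx))) (fun x _ => hH1 x) hD
  refine hcover.hasEulerChar (fun i => ?_) hUχ hUSχ
  exact (convex_convexHull ℝ _).cocycles_le_coboundaries
    ((Finset.coe_nonempty.2 (hT.nonempty σ hσ)).convexHull) hScomp i

omit [FiniteDimensional ℝ V] in
theorem IsSimplicialComplex.mono {T T' : Finset (Finset V)} (hT : IsSimplicialComplex T)
    (h : T' ⊆ T) (hd : ∀ s ∈ T', ∀ t ⊆ s, t.Nonempty → t ∈ T') : IsSimplicialComplex T' :=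
  ⟨fun s hs => hT.nonempty s (h hs), hd, fun s hs => hT.indep s (h hs),
    fun s hs t ht => hT.inter_subset s (h hs) t (h ht)⟩

/-- The reduced Euler characteristic of a polyhedron (up to sign), in terms of its faces. -/
theorem IsSimplicialComplex.hasEulerChar {T : Finset (Finset V)} (hT : IsSimplicialComplex T) :
    HasEulerChar (realization T) (1 + ∑ s ∈ T, (-1) ^ s.card) := by
  classical
  induction hn : T.card using Nat.strong_induction_on generalizing T with
  | _ n ih =>
  subst hn
  rcases T.eq_empty_or_nonempty with rfl | hne
  · simpa [realization] using hasEulerChar_empty V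
  -- A simplex of maximal cardinality is a proper face of no other, so erasing it leaves a complex.
  obtain ⟨σ, hσ, hmax⟩ := T.exists_max_image Finset.card hne
  have hcard : (T.erase σ).card < T.card := Finset.card_erase_lt_of_mem hσ
  have hsub : properFaces σ ⊆ T.erase σ := fun s hs => by
    obtain ⟨h1, h2⟩ := mem_properFaces.1 hs
    exact Finset.mem_erase.2 ⟨h1.ne, hT.down_closed σ hσ s h1.1 h2⟩
  have hF := ih _ hcard (hT.mono (Finset.erase_subset σ T) fun s hs t hts ht => by
    obtain ⟨h1, h2⟩ := Finset.mem_erase.1 hs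
    refine Finset.mem_erase.2 ⟨fun h => h1 ?_, hT.down_closed s h2 t hts ht⟩
    subst h
    exact (Finset.eq_of_subset_of_card_le hts (hmax s h2)).symm) rfl
  have hD := ih _ ((Finset.card_le_card hsub).trans_lt hcard)
    (hT.mono (hsub.trans (Finset.erase_subset _ _)) fun s hs t hts ht => by
      obtain ⟨h1, -⟩ := mem_properFaces.1 hs
      exact mem_properFaces.2 ⟨hts.trans_ssubset h1, ht⟩) rfl
  have key := hT.hasEulerChar_of_erase hσ hmax hF hD
  have hne' := hT.nonempty σ hσ
  -- Splitting ∅ and σ off the vanishing sum over all subsets of σ shows that ∂σ contributes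
  -- -(-1)^|σ|.
  have hsum := Finset.sum_powerset_neg_one_pow_card_of_nonempty hne'
  rw [← Finset.add_sum_erase _ _ (Finset.empty_mem_powerset σ),
    ← Finset.add_sum_erase _ _ (Finset.mem_erase.2 ⟨hne'.ne_empty, Finset.mem_powerset_self σ⟩),
    Finset.card_empty, pow_zero] at hsum
  rw [← Finset.add_sum_erase _ _ hσ]
  convert key using 1
  rw [properFaces]
  linarith

end Induction

/-! ### Power series and binomial sums -/

section Series

theorem eq_C_mul_one_add_X_inv_iff {K : Type*} [Field K] (γ : K⟦X⟧) (k : K) :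
    γ = PowerSeries.C k * (1 + PowerSeries.X)⁻¹ ↔
      ∀ n, PowerSeries.coeff n γ = (-1) ^ n * k := by
  rw [PowerSeries.eq_mul_inv_iff_mul_eq (by simp), mul_add, mul_one]
  constructor
  · intro h n
    induction n with
    | zero =>
      have := congrArg (PowerSeries.coeff 0) h
      simpa using this
    | succ n ih =>
      have := congrArg (PowerSeries.coeff (n + 1)) h
      rw [map_add, PowerSeries.coeff_succ_mul_X, PowerSeries.coeff_C, if_neg (by omega), ih] at this
      rw [eq_neg_of_add_eq_zero_left this]
      ring
  · intro h
    ext n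
    cases n with
    | zero => simpa using h 0
    | succ n =>
      rw [map_add, PowerSeries.coeff_succ_mul_X, PowerSeries.coeff_C, if_neg (by omega), h, h]
      ring

theorem sum_neg_one_pow_mul_choose_succ {K : Type*} [CommRing K] (n : ℕ) :
    ∑ k ∈ Finset.range (n + 1), (-1 : K) ^ k * ((n + 1).choose (k + 1) : K) = 1 := by
  have h := Int.alternating_sum_range_choose (n := n + 1)
  rw [if_neg (by omega), Finset.sum_range_succ'] at h
  have h' : ∑ k ∈ Finset.range (n + 1), (-1 : ℤ) ^ k * ((n + 1).choose (k + 1) : ℤ) = 1 := by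
    simp only [pow_succ, mul_neg, mul_one, neg_mul, Finset.sum_neg_distrib, pow_zero,
      Nat.choose_zero_right, Nat.cast_one] at h
    linarith
  have := congrArg (Int.cast : ℤ → K) h'
  push_cast at this
  exact this

/-- The system is triangular with diagonal entries C(n+1, n+1) = 1, so no division is needed. -/
theorem eq_of_sum_mul_choose_succ_eq {K : Type*} [CommRing K] {a c : ℕ → K}
    (h : ∀ n, ∑ k ∈ Finset.range (n + 1), a k * ((n + 1).choose (k + 1) : K) =
      ∑ k ∈ Finset.range (n + 1), c k * ((n + 1).choose (k + 1) : K)) (n : ℕ) : a n = c n := by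
  induction n using Nat.strong_induction_on with
  | _ n ih =>
  have := h n
  rw [Finset.sum_range_succ, Finset.sum_range_succ, Nat.choose_self, Nat.cast_one, mul_one,
    mul_one, Finset.sum_congr rfl fun k hk => by rw [ih k (Finset.mem_range.1 hk)]] at this
  exact add_left_cancel this

end Series

/-! ### Face numbers of finite complexes -/

namespace FiniteComplex

/-- The finite set of faces. -/
noncomputable def faceFinset (F : FiniteComplex) :
    Finset (Finset (EuclideanSpace ℝ (Fin F.ambientDim))) := F.finite_faces.toFinset

theorem mem_faceFinset {F : FiniteComplex} {s : Finset (EuclideanSpace ℝ (Fin F.ambientDim))} :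
    s ∈ F.faceFinset ↔ s ∈ F.complex.faces := F.finite_faces.mem_toFinset

theorem isSimplicialComplex_faceFinset (F : FiniteComplex) : IsSimplicialComplex F.faceFinset where
  nonempty _ hs := F.complex.nonempty_of_mem_faces (mem_faceFinset.1 hs)
  down_closed _ hs _ hts ht := mem_faceFinset.2 (F.complex.down_closed (mem_faceFinset.1 hs) hts ht)
  indep _ hs := F.complex.indep (mem_faceFinset.1 hs)
  inter_subset _ hs _ ht :=
    F.complex.inter_subset_convexHull (mem_faceFinset.1 hs) (mem_faceFinset.1 ht)

theorem realization_faceFinset (F : FiniteComplex) : realization F.faceFinset = F.polyhedron := by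
  ext x
  rw [mem_realization, polyhedron, Geometry.SimplicialComplex.mem_space_iff]
  simp only [mem_faceFinset]

theorem isCompact_polyhedron (F : FiniteComplex) : IsCompact F.polyhedron := by
  rw [← realization_faceFinset]
  exact isCompact_realization _

theorem sum_neg_one_pow_card_eq_of_homotopyEquiv {F G : FiniteComplex}
    (e : ContinuousMap.HomotopyEquiv F.polyhedron G.polyhedron) :
    ∑ s ∈ F.faceFinset, (-1 : ℤ) ^ s.card = ∑ s ∈ G.faceFinset, (-1) ^ s.card := by
  have hF := F.isSimplicialComplex_faceFinset.hasEulerChar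
  have hG := G.isSimplicialComplex_faceFinset.hasEulerChar
  rw [realization_faceFinset] at hF hG
  have := (hF.congr_homotopyEquiv F.isCompact_polyhedron G.isCompact_polyhedron e).unique hG
  linarith

theorem fVector_eq_card (F : FiniteComplex) (k : ℕ) :
    F.fVector k = (F.faceFinset.filter fun s => s.card = k + 1).card := by
  rw [fVector, ← Set.ncard_coe_finset]
  congr 1
  ext s
  simp [mem_faceFinset]

theorem card_sub_one_le_dim {F : FiniteComplex}
    {s : Finset (EuclideanSpace ℝ (Fin F.ambientDim))} (hs : s ∈ F.complex.faces) :
    s.card - 1 ≤ F.dim :=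
  le_csSup (F.finite_faces.image _).bddAbove ⟨s, hs, rfl⟩

theorem sum_neg_one_pow_mul_fVector (F : FiniteComplex) :
    ∑ k ∈ Finset.range (F.dim + 1), (-1 : ℤ) ^ k * (F.fVector k : ℤ) =
      -∑ s ∈ F.faceFinset, (-1) ^ s.card := by
  rw [← Finset.sum_fiberwise_of_maps_to (g := fun s => s.card - 1)
    (t := Finset.range (F.dim + 1)) fun s hs => Finset.mem_range.2
      (Nat.lt_succ_of_le (card_sub_one_le_dim (mem_faceFinset.1 hs))), ← Finset.sum_neg_distrib]
  refine Finset.sum_congr rfl fun k _ => ?_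
  -- Truncated subtraction is harmless because faces are non-empty.
  have hfilter : (F.faceFinset.filter fun s => s.card - 1 = k) =
      F.faceFinset.filter fun s => s.card = k + 1 := Finset.filter_congr fun s hs => by
    have := (F.isSimplicialComplex_faceFinset.nonempty s hs).card_pos
    omega
  rw [hfilter, Finset.sum_congr rfl fun s hs => by rw [(Finset.mem_filter.1 hs).2],
    Finset.sum_const, ← fVector_eq_card, nsmul_eq_mul]
  ring

theorem seriesChar_of_coeff_eq {K : Type*} [Field K] {γ : K⟦X⟧} {k : K}
    (h : ∀ n, PowerSeries.coeff n γ = (-1) ^ n * k) (F : FiniteComplex) :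
    seriesChar γ F = k * ((-∑ s ∈ F.faceFinset, (-1) ^ s.card : ℤ) : K) := by
  rw [← sum_neg_one_pow_mul_fVector, seriesChar]
  push_cast
  rw [Finset.mul_sum]
  exact Finset.sum_congr rfl fun n _ => by rw [h]; ring

/-! ### Full-dimensional simplices -/

section OfAffineBasis

variable {n : ℕ} (b : AffineBasis (Fin (n + 1)) ℝ (EuclideanSpace ℝ (Fin n)))

/-- The set of points of an affine basis. -/
noncomputable def basisVertices : Finset (EuclideanSpace ℝ (Fin n)) := Finset.univ.map ⟨b, b.ind.injective⟩

theorem coe_basisVertices : (basisVertices b : Set (EuclideanSpace ℝ (Fin n))) = Set.range b := by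
  simp [basisVertices]

theorem card_basisVertices : (basisVertices b).card = n + 1 := by simp [basisVertices]

theorem basisVertices_nonempty : (basisVertices b).Nonempty :=
  Finset.card_pos.1 (by rw [card_basisVertices]; omega)

/-- The simplicial complex of all faces of the simplex spanned by an affine basis. -/
noncomputable def simplexComplex : Geometry.SimplicialComplex ℝ (EuclideanSpace ℝ (Fin n)) where
  faces := {s | s.Nonempty ∧ s ⊆ basisVertices b}
  isRelLowerSet_faces := fun _ hs => ⟨hs.1, fun _ hts ht => ⟨ht, hts.trans hs.2⟩⟩
  indep := fun {s} hs =>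
    b.ind.range.mono ((Finset.coe_subset.2 hs.2).trans (coe_basisVertices b).subset)
  inter_subset_convexHull := fun {s t} hs ht => by
    classical
    have hind : AffineIndependent ℝ ((↑) : basisVertices b → EuclideanSpace ℝ (Fin n)) :=
      b.ind.range.mono (coe_basisVertices b).subset
    exact (hind.convexHull_inter hs.2 ht.2).ge

/-- A full-dimensional simplex, spanned by an affine basis, as a finite complex. -/
noncomputable def ofAffineBasis : FiniteComplex where
  ambientDim := n
  complex := simplexComplex b
  finite_faces := (Finset.finite_toSet (basisVertices b).powerset).subset
    fun _ hs => Finset.mem_coe.2 (Finset.mem_powerset.2 hs.2)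

theorem isSimplex_ofAffineBasis : (ofAffineBasis b).IsSimplex :=
  ⟨n, basisVertices b, card_basisVertices b, rfl⟩

theorem space_simplexComplex : (simplexComplex b).space = convexHull ℝ (Set.range b) := by
  ext x
  rw [Geometry.SimplicialComplex.mem_space_iff, ← coe_basisVertices]
  constructor
  · rintro ⟨s, hs, hx⟩
    exact convexHull_mono (Finset.coe_subset.2 hs.2) hx
  · exact fun hx => ⟨basisVertices b, ⟨basisVertices_nonempty b, le_rfl⟩, hx⟩

theorem polyhedron_ofAffineBasis :
    (ofAffineBasis b).polyhedron = convexHull ℝ (Set.range b) := space_simplexComplex b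

theorem isBall_ofAffineBasis : (ofAffineBasis b).IsBall := by
  have hc : IsCompact (convexHull ℝ (Set.range b)) := (Set.finite_range b).isCompact_convexHull ℝ
  -- The centroid of an affine basis is interior, so the simplex is a convex body and some
  -- self-homeomorphism of the space carries it to the unit ball.
  obtain ⟨h, -, hh, -⟩ := exists_homeomorph_image_interior_closure_frontier_eq_unitBall
    (convex_convexHull ℝ (Set.range b)) ⟨_, b.centroid_mem_interior_convexHull⟩ hc.isBounded
  rw [hc.isClosed.closure_eq] at hh
  refine ⟨n, ⟨(Homeomorph.setCongr (polyhedron_ofAffineBasis b)).trans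
    ((h.image _).trans (Homeomorph.setCongr hh))⟩⟩

theorem contractibleSpace_ofAffineBasis : ContractibleSpace (ofAffineBasis b).polyhedron := by
  have : ContractibleSpace (convexHull ℝ (Set.range b)) :=
    (convex_convexHull ℝ _).contractibleSpace (Set.range_nonempty _).convexHull
  exact @Homeomorph.contractibleSpace _ _ _ _ this (Homeomorph.setCongr (polyhedron_ofAffineBasis b))

theorem dim_ofAffineBasis : (ofAffineBasis b).dim = n := by
  refine IsGreatest.csSup_eq ⟨⟨basisVertices b, ⟨basisVertices_nonempty b, le_rfl⟩,
    congrArg (· - 1) (card_basisVertices b)⟩, ?_⟩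
  rintro _ ⟨s, hs, rfl⟩
  exact Nat.sub_le_of_le_add ((Finset.card_le_card hs.2).trans_eq (card_basisVertices b))

theorem fVector_ofAffineBasis (k : ℕ) : (ofAffineBasis b).fVector k = (n + 1).choose (k + 1) := by
  have h : {s ∈ (simplexComplex b).faces | s.card = k + 1} =
      ((basisVertices b).powersetCard (k + 1) : Set (Finset (EuclideanSpace ℝ (Fin n)))) := by
    ext s
    rw [Finset.mem_coe, Finset.mem_powersetCard]
    exact ⟨fun hs => ⟨hs.1.2, hs.2⟩,
      fun hs => ⟨⟨Finset.card_pos.1 (by rw [hs.2]; omega), hs.1⟩, hs.2⟩⟩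
  have h' := congrArg Set.ncard h
  rw [Set.ncard_coe_finset, Finset.card_powersetCard, card_basisVertices] at h'
  exact h'

theorem seriesChar_ofAffineBasis {K : Type*} [Field K] (γ : K⟦X⟧) :
    seriesChar γ (ofAffineBasis b) = ∑ k ∈ Finset.range (n + 1),
      PowerSeries.coeff k γ * ((n + 1).choose (k + 1) : K) := by
  simp only [seriesChar, dim_ofAffineBasis, fVector_ofAffineBasis]

end OfAffineBasis

end FiniteComplex

/-! ### The characterization -/

section Main

variable {K : Type*} [Field K] {γ : K⟦X⟧}

theorem IsHomotopyInvariantOn.mono {C D : Set FiniteComplex} (h : IsHomotopyInvariantOn γ D)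
    (hCD : C ⊆ D) : IsHomotopyInvariantOn γ C :=
  fun F hF G hG => h F (hCD hF) G (hCD hG)

theorem isHomotopyInvariantOn_univ_of_eq (h : ∃ k : K, γ = PowerSeries.C k * (1 + PowerSeries.X)⁻¹) :
    IsHomotopyInvariantOn γ Set.univ := by
  obtain ⟨k, h⟩ := h
  rw [eq_C_mul_one_add_X_inv_iff] at h
  rintro F - G - ⟨e⟩
  rw [FiniteComplex.seriesChar_of_coeff_eq h, FiniteComplex.seriesChar_of_coeff_eq h,
    FiniteComplex.sum_neg_one_pow_card_eq_of_homotopyEquiv e]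

theorem IsHomotopyInvariantOn.exists_eq {C : Set FiniteComplex} (h : IsHomotopyInvariantOn γ C)
    (hC : ∀ (n : ℕ) (b : AffineBasis (Fin (n + 1)) ℝ (EuclideanSpace ℝ (Fin n))),
      FiniteComplex.ofAffineBasis b ∈ C) :
    ∃ k : K, γ = PowerSeries.C k * (1 + PowerSeries.X)⁻¹ := by
  have hb : ∀ n : ℕ, Nonempty (AffineBasis (Fin (n + 1)) ℝ (EuclideanSpace ℝ (Fin n))) :=
    fun n => AffineBasis.exists_affineBasis_of_finiteDimensional (by simp)
  refine ⟨PowerSeries.coeff 0 γ, (eq_C_mul_one_add_X_inv_iff γ _).2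
    (eq_of_sum_mul_choose_succ_eq fun n => ?_)⟩
  obtain ⟨b⟩ := hb n
  obtain ⟨b₀⟩ := hb 0
  have := FiniteComplex.contractibleSpace_ofAffineBasis b
  have := FiniteComplex.contractibleSpace_ofAffineBasis b₀
  -- Comparison with a point, whose characteristic is γ_0.
  have key := h _ (hC n b) _ (hC 0 b₀) (ContractibleSpace.hequiv _ _)
  rw [FiniteComplex.seriesChar_ofAffineBasis, FiniteComplex.seriesChar_ofAffineBasis] at key
  rw [key, Finset.sum_congr rfl fun k _ => mul_right_comm _ _ _, ← Finset.sum_mul,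
    sum_neg_one_pow_mul_choose_succ]
  simp

end Main

theorem mainTheorem2 {K : Type*} [Field K] [CharZero K] (γ : K⟦X⟧) :
    (IsHomotopyInvariantOn γ {F | F.IsSimplex} ↔ ∃ k : K, γ = PowerSeries.C k * (1 + PowerSeries.X)⁻¹) ∧
    (IsHomotopyInvariantOn γ {F | F.IsBall} ↔ ∃ k : K, γ = PowerSeries.C k * (1 + PowerSeries.X)⁻¹) ∧
    (IsHomotopyInvariantOn γ Set.univ ↔ ∃ k : K, γ = PowerSeries.C k * (1 + PowerSeries.X)⁻¹) :=
  ⟨⟨fun h => h.exists_eq fun _ b => FiniteComplex.isSimplex_ofAffineBasis b,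
      fun h => (isHomotopyInvariantOn_univ_of_eq h).mono (Set.subset_univ _)⟩,
    ⟨fun h => h.exists_eq fun _ b => FiniteComplex.isBall_ofAffineBasis b,
      fun h => (isHomotopyInvariantOn_univ_of_eq h).mono (Set.subset_univ _)⟩,
    ⟨fun h => h.exists_eq fun _ _ => Set.mem_univ _, isHomotopyInvariantOn_univ_of_eq⟩⟩
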